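/- Let $\mathbb{F}_q$ be a finite field with $q$ elements, $A=\mathbb{F}_q[\theta]$, $K_\infty=\mathbb{F}_q((1/\theta))$, and let $\mathbb{C}_\infty$ be the completion of an algebraic closure of $K_\infty$, with absolute value normalized by $|\theta|_\infty=q$. For $s\ge 1$ let $\mathbb{T}_s$ be the Tate algebra of power series $f=\sum_\nu a_\nu t^\nu\in\mathbb{C}_\infty[[t_1,\dots,t_s]]$ with $|a_\nu|_\infty\to 0$ as $|\nu|\to\infty$, with the Gauss norm $\|f\|_\infty=\sup_\nu|a_\nu|_\infty$; for $n\in\mathbb{Z}$ put $f^{(n)}=\sum_\nu a_\nu^{q^n}t^\nu$, and twist power series in $z$ over $\mathbb{T}_s$, as well as vectors and matrices of such series, coefficientwise and entrywise. View $\mathbb{T}_s$ as an algebra over $A[\underline{t}_s]=A[t_1,\dots,t_s]$ in the natural way. Let $\mathbb{T}_s\{z/\theta\}$ be the ring of power series $\sum_{i\ge 0}a_iz^i\in\mathbb{T}_s[[z]]$ with $q^i\|a_i\|_\infty\to 0$ as $i\to\infty$. Let $\phi$ be a Drinfeld $A[\underline{t}_s]$-module of rank $r\ge 1$ over $\mathbb{T}_s$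 given by $\phi_\theta=\theta+A_1\tau+\cdots+A_r\tau^r$ with $A_1,\dots,A_r\in\mathbb{T}_s$ and $A_r\in\mathbb{T}_s^\times$, where $\tau f=f^{(1)}$ for $f\in\mathbb{T}_s$. Let $\exp_\phi=\sum_{i\ge 0}\alpha_i\tau^i$ be its exponential series, that is, the unique series in $\mathbb{T}_s[[\tau]]$ with $\alpha_0=1$ and $\exp_\phi\theta=\phi_\theta\exp_\phi$; it defines a function $\exp_\phi(f)=\sum_{i\ge0}\alpha_if^{(i)}$ on $\mathbb{T}_s$. Let $\Lambda_\phi=\ker(\exp_\phi)\subseteq\mathbb{T}_s$ be the period lattice, which is an $A[\underline{t}_s]$-submodule of $\mathbb{T}_s$. Put \[ \Phi=\begin{bmatrix} 0 & 1 & \cdots & 0\\ \vdots & \vdots & \ddots & \vdots\\ 0 & 0 & \cdots & 1\\ \dfrac{z-\theta}{A_r^{(-r)}} & -\dfrac{A_1^{(-1)}}{A_r^{(-r)}} & \cdots & -\dfrac{A_{r-1}^{(-r+1)}}{A_r^{(-r)}} \end{bmatrix}\in\mathrm{Mat}_r(\mathbb{T}_s[z]), \] \[ V_\phi=\{\mathbf{g}\in\mathrm{Mat}_{1\times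 r}(\mathbb{T}_s\{z/\theta\})\mid \mathbf{g}^{(-1)}\Phi=\mathbf{g}\}, \] and let $D_0\colon\mathrm{Mat}_{1\times r}(\mathbb{T}_s\{z/\theta\})\to\mathbb{T}_s$ be the map $[g_1,\dots,g_r]\mapsto g_1|_{z=\theta}$. Suppose that $\phi$ has a rigid analytic trivialization, that is, there is a matrix $\Psi\in\mathrm{GL}_r(\mathbb{T}_s\{z/\theta\})$ with $\Psi^{(-1)}=\Phi\Psi$ (an identity of matrices over $\mathbb{T}_s[[z]]$, as is the equation that defines $V_\phi$). Then $D_0$ restricts to a bijection $V_\phi\to\Lambda_\phi$, and $\Lambda_\phi$ is a free $A[\underline{t}_s]$-module of rank $r$. -/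

import Mathlib

namespace TateDrinfeld

noncomputable section

open Filter Topology
open scoped NNReal

/-! Throughout, `Fq` is a finite field with `q = Fintype.card Fq` elements. -/

section

variable (Fq : Type*) [Field Fq] [Fintype Fq]

/-- `K_∞ = 𝔽_q((1/θ))`: Laurent series over `Fq`, whose variable stands for `1/θ`. -/
def KInfty := LaurentSeries Fq

namespace KInfty

instance : Field (KInfty Fq) := inferInstanceAs (Field (LaurentSeries Fq))
instance : Algebra Fq (KInfty Fq) := inferInstanceAs (Algebra Fq (LaurentSeries Fq))
instance : Valued (KInfty Fq) (WithZero (Multiplicative ℤ)) :=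
  inferInstanceAs (Valued (LaurentSeries Fq) (WithZero (Multiplicative ℤ)))
instance : CompleteSpace (KInfty Fq) := inferInstanceAs (CompleteSpace (LaurentSeries Fq))

/-- The element `θ`, the inverse of the Laurent series variable. -/
def theta : KInfty Fq := HahnSeries.single (-1 : ℤ) (1 : Fq)

lemma one_lt_card : (1 : ℝ≥0) < Fintype.card Fq := by
  exact_mod_cast Fintype.one_lt_card

lemma v_theta : Valued.v (theta Fq) = WithZero.exp (1 : ℤ) := by
  have := LaurentSeries.valuation_single_zpow Fq (-1)
  simpa using! this

/-- The `∞`-adic valuation has rank one; the norm is normalized so that `‖θ‖ = q`. -/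
instance : Valuation.RankOne (Valued.v : Valuation (KInfty Fq) (WithZero (Multiplicative ℤ))) where
  hom' := (WithZeroMulInt.toNNReal (one_lt_card Fq).ne_zero).comp
    MonoidWithZeroHom.ValueGroup₀.embedding
  strictMono' := (WithZeroMulInt.toNNReal_strictMono (one_lt_card Fq)).comp
    MonoidWithZeroHom.ValueGroup₀.embedding_strictMono
  exists_val_nontrivial := ⟨theta Fq, by rw [v_theta]; simp, by rw [v_theta]; simp⟩

/-- The `∞`-adic absolute value on `K_∞`. -/
instance : NontriviallyNormedField (KInfty Fq) :=
  Valued.toNontriviallyNormedField (L := KInfty Fq) (Γ₀ := WithZero (Multiplicative ℤ))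
instance : IsUltrametricDist (KInfty Fq) := inferInstance

lemma norm_theta : ‖theta Fq‖ = Fintype.card Fq := by
  change ((WithZeroMulInt.toNNReal (one_lt_card Fq).ne_zero
    (MonoidWithZeroHom.ValueGroup₀.embedding (Valued.v.restrict (theta Fq))) : ℝ≥0) : ℝ) = _
  rw [Valuation.embedding_restrict, v_theta, WithZeroMulInt.toNNReal_neg_apply _ (by simp)]
  simp [WithZero.exp]

end KInfty

/-- An algebraic closure of `K_∞`, with the unique extension of the absolute value. -/
abbrev AlgClosureKInfty := AlgebraicClosure (KInfty Fq)

instance : NormedField (AlgClosureKInfty Fq) :=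
  spectralNorm.normedField (KInfty Fq) (AlgClosureKInfty Fq)

instance : NormedAlgebra (KInfty Fq) (AlgClosureKInfty Fq) := spectralNorm.normedAlgebra _ _

instance : IsUltrametricDist (AlgClosureKInfty Fq) :=
  IsUltrametricDist.isUltrametricDist_of_forall_norm_add_le_max_norm
    (isNonarchimedean_spectralNorm (K := KInfty Fq) (L := AlgClosureKInfty Fq))


/-- `ℂ_∞`, the completion of an algebraic closure of `K_∞`. -/
abbrev CInfty := UniformSpace.Completion (AlgClosureKInfty Fq)

namespace CInfty

instance : Algebra Fq (CInfty Fq) :=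
  ((algebraMap (KInfty Fq) (CInfty Fq)).comp (algebraMap Fq (KInfty Fq))).toAlgebra

instance : IsUltrametricDist (CInfty Fq) := IsUltrametricDist.of_normedAlgebra (KInfty Fq)

/-- The element `θ` of `ℂ_∞`. -/
def theta : CInfty Fq := algebraMap (KInfty Fq) (CInfty Fq) (KInfty.theta Fq)

lemma norm_theta : ‖theta Fq‖ = Fintype.card Fq := by
  rw [theta, norm_algebraMap', KInfty.norm_theta]

lemma frobenius_isUniformInducing :
    IsUniformInducing (FiniteField.frobeniusAlgHom Fq (CInfty Fq)) := by
  have hq : Fintype.card Fq ≠ 0 := Fintype.card_ne_zero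
  rw [Metric.isUniformInducing_iff, Metric.uniformContinuous_iff]
  have key : ∀ x y : CInfty Fq, dist (FiniteField.frobeniusAlgHom Fq (CInfty Fq) x)
      (FiniteField.frobeniusAlgHom Fq (CInfty Fq) y) = dist x y ^ Fintype.card Fq := by
    intro x y
    rw [dist_eq_norm, ← map_sub, FiniteField.frobeniusAlgHom_apply, norm_pow, dist_eq_norm]
  simp only [key]
  refine ⟨fun ε hε => ⟨min ε 1, by positivity, fun {a b} h => ?_⟩, fun δ hδ =>
    ⟨δ ^ Fintype.card Fq, by positivity, fun {a b} h => lt_of_pow_lt_pow_left₀ _ hδ.le h⟩⟩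
  exact (pow_le_of_le_one dist_nonneg (h.le.trans (min_le_right _ _)) hq).trans_lt
    (h.trans_le (min_le_left _ _))

lemma frobenius_bijective :
    Function.Bijective (FiniteField.frobeniusAlgHom Fq (CInfty Fq)) := by
  refine ⟨RingHom.injective (FiniteField.frobeniusAlgHom Fq (CInfty Fq)).toRingHom, ?_⟩
  have hcl : IsClosed (Set.range (FiniteField.frobeniusAlgHom Fq (CInfty Fq))) :=
    (frobenius_isUniformInducing Fq).isComplete_range.isClosed
  have hd : Dense (Set.range (FiniteField.frobeniusAlgHom Fq (CInfty Fq))) := by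
    refine (UniformSpace.Completion.denseRange_coe (α := AlgClosureKInfty Fq)).mono ?_
    rintro _ ⟨a, rfl⟩
    obtain ⟨b, hb⟩ := IsAlgClosed.exists_pow_nat_eq a (n := Fintype.card Fq) Fintype.card_pos
    refine ⟨(b : CInfty Fq), ?_⟩
    rw [FiniteField.frobeniusAlgHom_apply, ← hb]
    exact (map_pow (UniformSpace.Completion.coeRingHom (α := AlgClosureKInfty Fq)) b _).symm
  intro x
  have := hcl.closure_eq ▸ hd x
  exact this

/-- The `q`-power Frobenius automorphism `x ↦ x ^ q` of the perfect field `ℂ_∞`. -/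
def frob : CInfty Fq ≃+* CInfty Fq :=
  RingEquiv.ofBijective (FiniteField.frobeniusAlgHom Fq (CInfty Fq)) (frobenius_bijective Fq)

lemma frob_apply (x : CInfty Fq) : frob Fq x = x ^ Fintype.card Fq := rfl

lemma norm_frob (x : CInfty Fq) : ‖frob Fq x‖ = ‖x‖ ^ Fintype.card Fq := by
  rw [frob_apply, norm_pow]

lemma tendsto_frob {ι : Type*} {l : Filter ι} {a : ι → CInfty Fq} :
    Tendsto (fun i => ‖frob Fq (a i)‖) l (𝓝 0) ↔ Tendsto (fun i => ‖a i‖) l (𝓝 0) := by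
  rw [← tendsto_zero_iff_norm_tendsto_zero, ← tendsto_zero_iff_norm_tendsto_zero]
  have := ((frobenius_isUniformInducing Fq).isInducing.tendsto_nhds_iff (f := a) (l := l) (y := 0))
  rw [map_zero] at this
  exact this.symm

end CInfty


/-- The Tate algebra `𝕋_s` of power series `∑ a_ν t^ν` in `t_1, …, t_s` over `ℂ_∞` with
`‖a_ν‖ → 0` as `|ν| → ∞`. -/
def Tate (s : ℕ) := ↥(MvPowerSeries.IsRestricted.subring (fun _ : Fin s => (1 : ℝ)) :
    Subring (MvPowerSeries (Fin s) (CInfty Fq)))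

namespace Tate
variable (s : ℕ)

instance : CommRing (Tate Fq s) := inferInstanceAs (CommRing
  ↥(MvPowerSeries.IsRestricted.subring (fun _ : Fin s => (1 : ℝ)) :
    Subring (MvPowerSeries (Fin s) (CInfty Fq))))

variable {Fq s}

lemma isRestricted_iff (f : MvPowerSeries (Fin s) (CInfty Fq)) :
    MvPowerSeries.IsRestricted (fun _ : Fin s => (1 : ℝ)) f ↔
      Tendsto (fun ν => ‖MvPowerSeries.coeff ν f‖) cofinite (𝓝 0) := by
  simp [MvPowerSeries.IsRestricted, Finsupp.prod]

/-- The coefficient `a_ν` of `f = ∑ a_ν t^ν`. -/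
def coeff (ν : Fin s →₀ ℕ) (f : Tate Fq s) : CInfty Fq := MvPowerSeries.coeff ν f.1

/-- The element of the Tate algebra given by a power series with coefficients tending to zero. -/
def mk (f : MvPowerSeries (Fin s) (CInfty Fq))
    (hf : Tendsto (fun ν => ‖MvPowerSeries.coeff ν f‖) cofinite (𝓝 0)) : Tate Fq s :=
  ⟨f, (isRestricted_iff f).2 hf⟩

lemma tendsto_coeff (f : Tate Fq s) : Tendsto (fun ν => ‖coeff ν f‖) cofinite (𝓝 0) :=
  (isRestricted_iff f.1).1 f.2

lemma bddAbove (f : Tate Fq s) : BddAbove (Set.range fun ν => ‖coeff ν f‖) := by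
  have h := (tendsto_coeff f).eventually (gt_mem_nhds zero_lt_one)
  rw [Filter.eventually_cofinite] at h
  obtain ⟨M, hM⟩ := (h.image fun ν => ‖coeff ν f‖).bddAbove
  refine ⟨max M 1, ?_⟩
  rintro _ ⟨ν, rfl⟩
  by_cases hν : ‖coeff ν f‖ < 1
  · exact hν.le.trans (le_max_right _ _)
  · exact (hM ⟨ν, hν, rfl⟩).trans (le_max_left _ _)

@[ext] lemma ext {f g : Tate Fq s} (h : ∀ ν, coeff ν f = coeff ν g) : f = g :=
  Subtype.ext (MvPowerSeries.ext h)

/-- The Gauss norm `sup_ν ‖a_ν‖`. -/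
def gauss (f : Tate Fq s) : ℝ := ⨆ ν, ‖coeff ν f‖

lemma coeff_le_gauss (f : Tate Fq s) (ν : Fin s →₀ ℕ) : ‖coeff ν f‖ ≤ gauss f :=
  le_ciSup (bddAbove f) ν

lemma gauss_le {f : Tate Fq s} {B : ℝ} (h : ∀ ν, ‖coeff ν f‖ ≤ B) : gauss f ≤ B := ciSup_le h

lemma gauss_nonneg (f : Tate Fq s) : 0 ≤ gauss f :=
  (norm_nonneg _).trans (coeff_le_gauss f 0)

lemma coeff_zero (ν : Fin s →₀ ℕ) : coeff ν (0 : Tate Fq s) = 0 := rfl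
lemma coeff_add (ν : Fin s →₀ ℕ) (f g : Tate Fq s) :
    coeff ν (f + g) = coeff ν f + coeff ν g := rfl
lemma coeff_sub (ν : Fin s →₀ ℕ) (f g : Tate Fq s) :
    coeff ν (f - g) = coeff ν f - coeff ν g := rfl
lemma coeff_neg (ν : Fin s →₀ ℕ) (f : Tate Fq s) : coeff ν (-f) = -coeff ν f := rfl
lemma coeff_mul (ν : Fin s →₀ ℕ) (f g : Tate Fq s) :
    coeff ν (f * g) = ∑ p ∈ Finset.HasAntidiagonal.antidiagonal ν, coeff p.1 f * coeff p.2 g := by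
  classical
  exact MvPowerSeries.coeff_mul ..

lemma gauss_add_le_max (f g : Tate Fq s) : gauss (f + g) ≤ max (gauss f) (gauss g) :=
  gauss_le fun ν => (IsUltrametricDist.norm_add_le_max _ _).trans
    (max_le_max (coeff_le_gauss f ν) (coeff_le_gauss g ν))

lemma gauss_mul_le (f g : Tate Fq s) : gauss (f * g) ≤ gauss f * gauss g := by
  refine gauss_le fun ν => ?_
  rw [coeff_mul]
  refine IsUltrametricDist.norm_sum_le_of_forall_le_of_nonneg
    (mul_nonneg (gauss_nonneg f) (gauss_nonneg g)) fun p _ => ?_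
  rw [norm_mul]
  exact mul_le_mul (coeff_le_gauss f _) (coeff_le_gauss g _) (norm_nonneg _) (gauss_nonneg f)

/-- The Gauss norm as a ring norm. -/
def gaussRingNorm : RingNorm (Tate Fq s) where
  toFun := gauss
  map_zero' := by simp [gauss, coeff_zero]
  add_le' f g := (gauss_add_le_max f g).trans
    (max_le_add_of_nonneg (gauss_nonneg f) (gauss_nonneg g))
  neg' f := by simp [gauss, coeff_neg]
  mul_le' := gauss_mul_le
  eq_zero_of_map_eq_zero' f hf := ext fun ν =>
    norm_le_zero_iff.1 ((coeff_le_gauss f ν).trans hf.le)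

/-- The Tate algebra with its Gauss norm. -/
instance : NormedCommRing (Tate Fq s) :=
  { (inferInstance : CommRing (Tate Fq s)),
    (RingNorm.toNormedRing gaussRingNorm : NormedRing (Tate Fq s)).toMetricSpace with
    norm := gauss
    dist_eq := (RingNorm.toNormedRing gaussRingNorm : NormedRing (Tate Fq s)).dist_eq
    norm_mul_le := gauss_mul_le }

lemma norm_def (f : Tate Fq s) : ‖f‖ = ⨆ ν, ‖coeff ν f‖ := rfl
lemma coeff_le_norm (f : Tate Fq s) (ν : Fin s →₀ ℕ) : ‖coeff ν f‖ ≤ ‖f‖ := coeff_le_gauss f ν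
lemma norm_le {f : Tate Fq s} {B : ℝ} (h : ∀ ν, ‖coeff ν f‖ ≤ B) : ‖f‖ ≤ B := ciSup_le h

instance : IsUltrametricDist (Tate Fq s) :=
  IsUltrametricDist.isUltrametricDist_of_forall_norm_add_le_max_norm gauss_add_le_max

instance : CompleteSpace (Tate Fq s) := by
  refine Metric.complete_of_cauchySeq_tendsto fun u hu => ?_
  have hc : ∀ ν, CauchySeq fun n => coeff ν (u n) := fun ν => by
    rw [Metric.cauchySeq_iff] at hu ⊢
    intro ε hε
    obtain ⟨N, hN⟩ := hu ε hε
    refine ⟨N, fun m hm n hn => lt_of_le_of_lt ?_ (hN m hm n hn)⟩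
    rw [dist_eq_norm, dist_eq_norm, ← coeff_sub]
    exact coeff_le_norm _ _
  choose a ha using fun ν => cauchySeq_tendsto_of_complete (hc ν)
  have hun : ∀ ε > 0, ∃ N, ∀ n ≥ N, ∀ ν, ‖coeff ν (u n) - a ν‖ ≤ ε := by
    intro ε hε
    obtain ⟨N, hN⟩ := Metric.cauchySeq_iff.1 hu ε hε
    refine ⟨N, fun n hn ν => ?_⟩
    refine le_of_tendsto ((tendsto_const_nhds.sub (ha ν)).norm) ?_
    filter_upwards [eventually_ge_atTop N] with m hm
    have := (hN n hn m hm).le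
    rw [dist_eq_norm] at this
    exact (coeff_le_norm (u n - u m) ν).trans this
  have hr : Tendsto (fun ν => ‖a ν‖) cofinite (𝓝 0) := by
    rw [Metric.tendsto_nhds]
    intro ε hε
    obtain ⟨N, hN⟩ := hun (ε / 2) (by positivity)
    filter_upwards [(tendsto_coeff (u N)).eventually (gt_mem_nhds (half_pos hε))] with ν hν
    have h1 := hN N le_rfl ν
    have h2 : ‖a ν‖ ≤ ‖coeff ν (u N)‖ + ‖coeff ν (u N) - a ν‖ := by
      have := norm_sub_le (coeff ν (u N)) (coeff ν (u N) - a ν)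
      simpa using this
    simp only [Real.dist_eq, sub_zero, abs_norm]
    linarith
  refine ⟨mk a hr, ?_⟩
  rw [Metric.tendsto_atTop]
  intro ε hε
  obtain ⟨N, hN⟩ := hun (ε / 2) (by positivity)
  refine ⟨N, fun n hn => ?_⟩
  rw [dist_eq_norm]
  exact (norm_le fun ν => hN n hn ν).trans_lt (half_lt_self hε)

/-- The twisting automorphism `τ (∑ a_ν t^ν) = ∑ a_ν ^ q t^ν`. -/
def tau : Tate Fq s ≃+* Tate Fq s where
  toFun f := mk (MvPowerSeries.map (CInfty.frob Fq).toRingHom f.1) <| by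
    simpa using! (CInfty.tendsto_frob Fq).2 (tendsto_coeff f)
  invFun f := mk (MvPowerSeries.map (CInfty.frob Fq).symm.toRingHom f.1) <| by
    refine (CInfty.tendsto_frob Fq).1 ?_
    simpa using! tendsto_coeff f
  left_inv f := ext fun ν => by simp [coeff, mk]
  right_inv f := ext fun ν => by simp [coeff, mk]
  map_mul' f g := Subtype.ext (map_mul (MvPowerSeries.map (CInfty.frob Fq).toRingHom) f.1 g.1)
  map_add' f g := Subtype.ext (map_add (MvPowerSeries.map (CInfty.frob Fq).toRingHom) f.1 g.1)

lemma coeff_tau (ν : Fin s →₀ ℕ) (f : Tate Fq s) :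
    coeff ν (tau f) = coeff ν f ^ Fintype.card Fq := rfl

/-- The `n`-fold twist `f^{(n)} = τ^n f`, for `n ∈ ℤ`. -/
def twist (n : ℤ) : Tate Fq s ≃+* Tate Fq s :=
  ((tau : RingAut (Tate Fq s)) ^ n : RingAut (Tate Fq s))

lemma coeff_twist (n : ℕ) (ν : Fin s →₀ ℕ) (f : Tate Fq s) :
    coeff ν (twist n f) = coeff ν f ^ (Fintype.card Fq ^ n) := by
  induction n with
  | zero => simp [twist]
  | succ n ih =>
    have : twist ((n + 1 : ℕ) : ℤ) f = tau (twist n f) := by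
      simp only [twist, zpow_natCast, pow_succ']; rfl
    rw [this, coeff_tau, ih, ← pow_mul, pow_succ]

lemma twist_twist (m n : ℤ) (f : Tate Fq s) : twist m (twist n f) = twist (m + n) f := by
  simp only [twist, zpow_add]; rfl

lemma norm_twist_le (n : ℕ) (f : Tate Fq s) : ‖twist n f‖ ≤ ‖f‖ ^ (Fintype.card Fq ^ n) :=
  norm_le fun ν => by
    rw [coeff_twist, norm_pow]
    exact pow_le_pow_left₀ (norm_nonneg _) (coeff_le_norm f ν) _

lemma continuous_twist (n : ℕ) : Continuous (twist (Fq := Fq) (s := s) n) := by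
  refine continuous_of_continuousAt_zero (twist (Fq := Fq) (s := s) n) ?_
  rw [ContinuousAt, map_zero]
  refine squeeze_zero_norm (norm_twist_le n) ?_
  have h : Continuous fun f : Tate Fq s => ‖f‖ ^ (Fintype.card Fq ^ n) := by fun_prop
  simpa using h.tendsto 0

variable (Fq s) in
/-- Constants. -/
def C : CInfty Fq →+* Tate Fq s :=
  (MvPowerSeries.C).codRestrict _ fun a => MvPowerSeries.isRestricted_C _ a

variable (Fq s) in
/-- The constant `θ` of the Tate algebra. -/
def theta : Tate Fq s := C Fq s (CInfty.theta Fq)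

/-- The variable `t_i`. -/
def X (i : Fin s) : Tate Fq s :=
  ⟨MvPowerSeries.X i, MvPowerSeries.isRestricted_monomial _ _ _⟩

lemma coeff_C (ν : Fin s →₀ ℕ) (a : CInfty Fq) : coeff ν (C Fq s a) = if ν = 0 then a else 0 := by
  classical
  exact MvPowerSeries.coeff_C ν a

lemma coeff_X (ν : Fin s →₀ ℕ) (i : Fin s) :
    coeff ν (X i : Tate Fq s) = if ν = Finsupp.single i 1 then 1 else 0 := by
  classical
  exact MvPowerSeries.coeff_X ν i

lemma norm_C (a : CInfty Fq) : ‖C Fq s a‖ = ‖a‖ := by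
  refine le_antisymm (norm_le fun ν => ?_) ?_
  · rw [coeff_C]; split_ifs <;> simp
  · simpa [coeff_C] using coeff_le_norm (C Fq s a) 0

lemma norm_theta : ‖theta Fq s‖ = Fintype.card Fq := by
  rw [theta, norm_C, CInfty.norm_theta]

lemma twist_C (n : ℕ) (a : CInfty Fq) :
    twist n (C Fq s a) = C Fq s (a ^ (Fintype.card Fq ^ n)) := by
  ext ν
  rw [coeff_twist, coeff_C, coeff_C]
  split_ifs <;> simp

lemma twist_X (n : ℕ) (i : Fin s) : twist n (X i : Tate Fq s) = X i := by
  ext ν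
  rw [coeff_twist, coeff_X]
  split_ifs <;> simp

variable (Fq s) in
/-- The natural map `A[t_s] = 𝔽_q[θ][t_1, …, t_s] → 𝕋_s`, where the polynomial variable of
`Polynomial Fq` goes to `θ`. -/
def ofPoly : MvPolynomial (Fin s) (Polynomial Fq) →+* Tate Fq s :=
  MvPolynomial.eval₂Hom ((C Fq s).comp (Polynomial.aeval (CInfty.theta Fq)).toRingHom) X

/-- `𝕋_s` as an `A[t_s]`-algebra. -/
instance : Algebra (MvPolynomial (Fin s) (Polynomial Fq)) (Tate Fq s) := (ofPoly Fq s).toAlgebra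

lemma norm_theta_pow_sub (n : ℕ) :
    ‖CInfty.theta Fq ^ (Fintype.card Fq ^ (n + 1)) - CInfty.theta Fq‖ =
      (Fintype.card Fq : ℝ) ^ (Fintype.card Fq ^ (n + 1)) := by
  have h1 : (1 : ℝ) < Fintype.card Fq := by exact_mod_cast Fintype.one_lt_card
  have h2 : ‖CInfty.theta Fq‖ < ‖CInfty.theta Fq ^ (Fintype.card Fq ^ (n + 1))‖ := by
    rw [norm_pow, CInfty.norm_theta]
    refine lt_self_pow₀ h1 ?_
    exact Nat.one_lt_pow (by omega) Fintype.one_lt_card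
  rw [sub_eq_add_neg, IsUltrametricDist.norm_add_eq_max_of_norm_ne_norm
    (by rw [norm_neg]; exact h2.ne'), norm_neg, max_eq_left h2.le, norm_pow, CInfty.norm_theta]

end Tate


/-- A Drinfeld `A[t_s]`-module of rank `r ≥ 1` over `𝕋_s` whose leading coefficient is a unit:
`φ_θ = θ + A_1 τ + ⋯ + A_r τ^r` with `A_r ∈ 𝕋_s^×`. It is given by the tuple `(A_1, …, A_r)`, on
which there is no further condition; `coeff k` is `A_{k+1}`. -/
structure DrinfeldModule (s r : ℕ) where
  coeff : Fin r → Tate Fq s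
  rank_pos : 0 < r
  isUnit_leading : IsUnit (coeff ⟨r - 1, Nat.sub_lt rank_pos one_pos⟩)

namespace DrinfeldModule
variable {Fq} {s r : ℕ} (φ : DrinfeldModule Fq s r)

/-- The operator `φ_θ f = θ f + A_1 f^{(1)} + ⋯ + A_r f^{(r)}` on `𝕋_s`. -/
def phiTheta (f : Tate Fq s) : Tate Fq s :=
  Tate.theta Fq s * f + ∑ k : Fin r, φ.coeff k * Tate.twist ((k : ℤ) + 1) f

/-- The coefficients `α_n` of the exponential series `exp_φ = ∑ α_n τ^n` of `φ`: the recursion is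
the one that `α_0 = 1` and `exp_φ θ = φ_θ exp_φ` impose, see `expCoeff_functional`. -/
def expCoeff : ℕ → Tate Fq s
  | 0 => 1
  | n + 1 => Tate.C Fq s ((CInfty.theta Fq ^ (Fintype.card Fq ^ (n + 1)) - CInfty.theta Fq)⁻¹) *
      ∑ k : Fin r, if (k : ℕ) ≤ n then
        φ.coeff k * Tate.twist ((k : ℤ) + 1) (expCoeff (n - k)) else 0
  decreasing_by omega

lemma expCoeff_zero : φ.expCoeff 0 = 1 := by rw [expCoeff]

/-- The coefficient of `τ^n` in `exp_φ θ = φ_θ exp_φ`. -/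
lemma expCoeff_functional (n : ℕ) :
    φ.expCoeff n * Tate.twist n (Tate.theta Fq s) = Tate.theta Fq s * φ.expCoeff n +
      ∑ k : Fin r, if (k : ℕ) + 1 ≤ n then
        φ.coeff k * Tate.twist ((k : ℤ) + 1) (φ.expCoeff (n - (k + 1))) else 0 := by
  cases n with
  | zero => simp [expCoeff_zero, Tate.twist]
  | succ n =>
    have h0 : CInfty.theta Fq ^ (Fintype.card Fq ^ (n + 1)) - CInfty.theta Fq ≠ 0 := by
      rw [← norm_ne_zero_iff, Tate.norm_theta_pow_sub]
      have : (0 : ℝ) < Fintype.card Fq := by exact_mod_cast Fintype.card_pos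
      positivity
    have h1 : Tate.twist ((n + 1 : ℕ) : ℤ) (Tate.theta Fq s) = Tate.theta Fq s +
        Tate.C Fq s (CInfty.theta Fq ^ (Fintype.card Fq ^ (n + 1)) - CInfty.theta Fq) := by
      rw [Tate.theta, Tate.twist_C, map_sub, add_sub_cancel]
    have h2 : Tate.C Fq s (CInfty.theta Fq ^ (Fintype.card Fq ^ (n + 1)) - CInfty.theta Fq) *
        Tate.C Fq s ((CInfty.theta Fq ^ (Fintype.card Fq ^ (n + 1)) - CInfty.theta Fq)⁻¹) = 1 := by
      rw [← map_mul, mul_inv_cancel₀ h0, map_one]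
    simp only [Nat.add_le_add_iff_right, Nat.add_sub_add_right]
    rw [h1, mul_add, mul_comm (φ.expCoeff (n + 1)), add_right_inj, mul_comm]
    conv_lhs => rw [expCoeff]
    rw [← mul_assoc, h2, one_mul]

lemma exists_norm_expCoeff_le : ∃ M ρ : ℝ, 0 ≤ M ∧ 0 < ρ ∧ ρ < 1 ∧
    ∀ n, ‖φ.expCoeff n‖ ≤ (M * ρ ^ n) ^ (Fintype.card Fq ^ n) := by
  set q := Fintype.card Fq with hq
  have hq1 : 1 < q := Fintype.one_lt_card
  have hqR : (1 : ℝ) < q := by exact_mod_cast hq1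
  have hr : (r : ℝ) ≠ 0 := by exact_mod_cast φ.rank_pos.ne'
  obtain ⟨B, hB⟩ := (Set.finite_range fun k : Fin r => ‖φ.coeff k‖).bddAbove
  set M := max B 1
  have hM1 : 1 ≤ M := le_max_right _ _
  have hMk : ∀ k, ‖φ.coeff k‖ ≤ M := fun k => (hB ⟨k, rfl⟩).trans (le_max_left _ _)
  set ρ : ℝ := ((q : ℝ)⁻¹) ^ ((r : ℝ)⁻¹) with hρ
  have hρ0 : 0 < ρ := Real.rpow_pos_of_pos (by positivity) _
  have hρ1 : ρ < 1 := Real.rpow_lt_one (by positivity) (inv_lt_one_of_one_lt₀ hqR) (by positivity)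
  have hρr : ρ ^ r = (q : ℝ)⁻¹ := Real.rpow_inv_natCast_pow (by positivity) φ.rank_pos.ne'
  have main : ∀ n, ‖φ.expCoeff n‖ ≤ M ^ (q ^ n - 1) * (ρ ^ n) ^ (q ^ n) := by
    intro n
    induction n using Nat.strong_induction_on with
    | _ n ih =>
      cases n with
      | zero =>
        rw [expCoeff_zero, ← map_one (Tate.C Fq s), Tate.norm_C]
        simp
      | succ n =>
        rw [expCoeff]
        refine (norm_mul_le _ _).trans ?_
        rw [Tate.norm_C, norm_inv, Tate.norm_theta_pow_sub, ← hq, inv_mul_le_iff₀ (by positivity)]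
        refine IsUltrametricDist.norm_sum_le_of_forall_le_of_nonneg (by positivity) fun k _ => ?_
        split_ifs with hk
        swap
        · rw [norm_zero]; positivity
        have hk' : n - k < n + 1 := by omega
        have e1 : q ^ (n - k) * q ^ ((k : ℕ) + 1) = q ^ (n + 1) := by
          rw [← pow_add]; congr 1; omega
        have hqk : 2 ≤ q ^ ((k : ℕ) + 1) := Nat.one_lt_pow (by omega) hq1
        have hle : q ^ ((k : ℕ) + 1) ≤ q ^ (n + 1) := Nat.pow_le_pow_right (by omega) (by omega)
        have tw : ‖Tate.twist ((k : ℤ) + 1) (φ.expCoeff (n - k))‖ ≤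
            ‖φ.expCoeff (n - k)‖ ^ (q ^ ((k : ℕ) + 1)) := by
          exact_mod_cast Tate.norm_twist_le ((k : ℕ) + 1) (φ.expCoeff (n - k))
        calc ‖φ.coeff k * Tate.twist ((k : ℤ) + 1) (φ.expCoeff (n - k))‖
            ≤ M * (M ^ (q ^ (n - k) - 1) * (ρ ^ (n - k)) ^ (q ^ (n - k))) ^ (q ^ ((k : ℕ) + 1)) := by
              refine (norm_mul_le _ _).trans (mul_le_mul (hMk k) (tw.trans ?_) (norm_nonneg _)
                (by positivity))
              exact pow_le_pow_left₀ (norm_nonneg _) (ih _ hk') _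
          _ = M ^ (1 + (q ^ (n + 1) - q ^ ((k : ℕ) + 1))) * (ρ ^ (n - k)) ^ (q ^ (n + 1)) := by
              rw [mul_pow, ← pow_mul, ← pow_mul (ρ ^ (n - (k : ℕ))), e1, Nat.sub_mul, one_mul, e1,
                ← mul_assoc, ← pow_succ', add_comm 1]
          _ ≤ M ^ (q ^ (n + 1) - 1) * ((q : ℝ) * ρ ^ (n + 1)) ^ (q ^ (n + 1)) := by
              refine mul_le_mul (pow_le_pow_right₀ hM1 (by omega)) ?_ (by positivity)
                (by positivity)
              refine pow_le_pow_left₀ (by positivity) ?_ _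
              have h3 : ρ ^ (n + 1) = ρ ^ (n - (k : ℕ)) * ρ ^ ((k : ℕ) + 1) := by
                rw [← pow_add]; congr 1; omega
              have h4 : (q : ℝ)⁻¹ ≤ ρ ^ ((k : ℕ) + 1) := by
                rw [← hρr]
                exact pow_le_pow_of_le_one hρ0.le hρ1.le (by have := k.2; omega)
              have h5 : 1 ≤ (q : ℝ) * ρ ^ ((k : ℕ) + 1) := by
                rw [inv_le_iff_one_le_mul₀ (by positivity)] at h4
                linarith
              rw [h3, mul_left_comm]
              exact le_mul_of_one_le_right (by positivity) h5
          _ = _ := by rw [mul_pow]; ring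
  refine ⟨M, ρ, by positivity, hρ0, hρ1, fun n => (main n).trans ?_⟩
  rw [mul_pow]
  exact mul_le_mul_of_nonneg_right (pow_le_pow_right₀ hM1 (Nat.sub_le _ _)) (by positivity)

/-- The exponential series is an entire operator: it converges at every `f ∈ 𝕋_s`. -/
lemma summable_exp (f : Tate Fq s) :
    Summable fun n : ℕ => φ.expCoeff n * Tate.twist n f := by
  refine NonarchimedeanAddGroup.summable_of_tendsto_cofinite_zero ?_
  rw [Nat.cofinite_eq_atTop]
  obtain ⟨M, ρ, hM, hρ0, hρ1, h⟩ := φ.exists_norm_expCoeff_le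
  have ht : Tendsto (fun n : ℕ => M * ρ ^ n * ‖f‖) atTop (𝓝 0) := by
    simpa using ((tendsto_pow_atTop_nhds_zero_of_lt_one hρ0.le hρ1).const_mul M).mul_const ‖f‖
  refine squeeze_zero_norm' ?_ ht
  filter_upwards [ht.eventually (ge_mem_nhds zero_lt_one)] with n hn
  calc ‖φ.expCoeff n * Tate.twist n f‖
      ≤ (M * ρ ^ n) ^ (Fintype.card Fq ^ n) * ‖f‖ ^ (Fintype.card Fq ^ n) :=
        (norm_mul_le _ _).trans (mul_le_mul (h n) (Tate.norm_twist_le n f) (norm_nonneg _)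
          (by positivity))
    _ = (M * ρ ^ n * ‖f‖) ^ (Fintype.card Fq ^ n) := by rw [← mul_pow]
    _ ≤ M * ρ ^ n * ‖f‖ := pow_le_of_le_one (by positivity) hn
        (pow_pos Fintype.card_pos n).ne'

/-- The exponential function `exp_φ f = ∑ α_n f^{(n)}` on `𝕋_s`. -/
def exp (f : Tate Fq s) : Tate Fq s := ∑' n : ℕ, φ.expCoeff n * Tate.twist n f

lemma exp_zero : φ.exp 0 = 0 := by simp [exp]

lemma exp_add (f g : Tate Fq s) : φ.exp (f + g) = φ.exp f + φ.exp g := by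
  simp only [exp, map_add, mul_add]
  exact (φ.summable_exp f).tsum_add (φ.summable_exp g)

lemma exp_mul_of_fixed {a : Tate Fq s} (ha : ∀ n : ℕ, Tate.twist n a = a) (f : Tate Fq s) :
    φ.exp (a * f) = a * φ.exp f := by
  simp only [exp, map_mul, ha]
  rw [← (φ.summable_exp f).tsum_mul_left]
  exact tsum_congr fun n => by ring

lemma exp_theta_mul (f : Tate Fq s) :
    φ.exp (Tate.theta Fq s * f) = φ.phiTheta (φ.exp f) := by
  have h0 := (φ.summable_exp f).hasSum
  have hk : ∀ k : Fin r, HasSum (fun n : ℕ => if (k : ℕ) + 1 ≤ n then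
      φ.coeff k * Tate.twist ((k : ℤ) + 1) (φ.expCoeff (n - (k + 1))) * Tate.twist n f else 0)
      (φ.coeff k * Tate.twist ((k : ℤ) + 1) (φ.exp f)) := by
    intro k
    have h1 := ((h0.map (Tate.twist (Fq := Fq) (s := s) (((k : ℕ) + 1 : ℕ) : ℤ))
      (Tate.continuous_twist _)).mul_left (φ.coeff k))
    rw [← hasSum_nat_add_iff' ((k : ℕ) + 1), Finset.sum_eq_zero, sub_zero]
    · refine Eq.mpr (congrArg (fun g => HasSum g _) (funext fun n => ?_)) h1
      rw [if_pos (by omega), Function.comp, map_mul, Tate.twist_twist, Nat.add_sub_cancel,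
        ← mul_assoc]
      push_cast
      rw [add_comm (n : ℤ)]
    · intro n hn
      rw [Finset.mem_range] at hn
      rw [if_neg (by omega)]
  have hs := (h0.mul_left (Tate.theta Fq s)).add (hasSum_sum fun k (_ : k ∈ Finset.univ) => hk k)
  rw [phiTheta, ← exp] at *
  refine Eq.trans (tsum_congr fun n => ?_) hs.tsum_eq
  rw [map_mul, ← mul_assoc, φ.expCoeff_functional, add_mul, mul_assoc, Finset.sum_mul]
  simp only [ite_mul, zero_mul]

lemma exp_C_mul (c : Fq) (f : Tate Fq s) :
    φ.exp (Tate.C Fq s (algebraMap Fq _ c) * f) = Tate.C Fq s (algebraMap Fq _ c) * φ.exp f :=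
  φ.exp_mul_of_fixed (fun n => by
    rw [Tate.twist_C, ← map_pow, FiniteField.pow_card_pow]) f

/-- The period lattice `Λ_φ = ker exp_φ`, an `A[t_s]`-submodule of `𝕋_s`. -/
def periodLattice : Submodule (MvPolynomial (Fin s) (Polynomial Fq)) (Tate Fq s) where
  carrier := {l | φ.exp l = 0}
  zero_mem' := φ.exp_zero
  add_mem' {a b} ha hb := by
    rw [Set.mem_ofPred_eq] at *
    rw [exp_add, ha, hb, add_zero]
  smul_mem' a l hl := by
    rw [Set.mem_ofPred_eq] at *
    have hθ : ∀ f, φ.exp f = 0 → φ.exp (Tate.theta Fq s * f) = 0 := fun f hf => by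
      rw [exp_theta_mul, hf]; simp [phiTheta]
    change φ.exp (Tate.ofPoly Fq s a * l) = 0
    induction a using MvPolynomial.induction_on generalizing l with
    | C p =>
      have e : Tate.ofPoly Fq s (MvPolynomial.C p) =
          Tate.C Fq s (Polynomial.aeval (CInfty.theta Fq) p) := by simp [Tate.ofPoly]
      rw [e]
      induction p using Polynomial.induction_on' with
      | add p₁ p₂ h₁ h₂ =>
        rw [map_add, map_add, add_mul, exp_add, h₁ (by simp [Tate.ofPoly]),
          h₂ (by simp [Tate.ofPoly]), add_zero]
      | monomial n c =>
        rw [Polynomial.aeval_monomial, map_mul, map_pow, mul_assoc, exp_C_mul]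
        refine mul_eq_zero_of_right _ ?_
        clear e
        change φ.exp (Tate.theta Fq s ^ n * l) = 0
        induction n with
        | zero => simpa using hl
        | succ n ih => rw [pow_succ', mul_assoc]; exact hθ _ ih
    | add p₁ p₂ h₁ h₂ => rw [map_add, add_mul, exp_add, h₁ l hl, h₂ l hl, add_zero]
    | mul_X p i h =>
      rw [map_mul, mul_assoc]
      refine h _ ?_
      have e : Tate.ofPoly Fq s (MvPolynomial.X i) = Tate.X i := by simp [Tate.ofPoly]
      rw [e, φ.exp_mul_of_fixed (fun n => Tate.twist_X n i), hl, mul_zero]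

end DrinfeldModule

/-- For `c ∈ 𝕋_s`, the ring `𝕋_s{z/c}` of power series `∑ a_i z^i` over `𝕋_s` with
`‖c‖^i ‖a_i‖ → 0` as `i → ∞`. -/
def TateDisc {Fq : Type*} [Field Fq] [Fintype Fq] {s : ℕ} (c : Tate Fq s) :
    Subring (PowerSeries (Tate Fq s)) :=
  PowerSeries.IsRestricted.subring ‖c‖

namespace TateDisc
variable {Fq} {s : ℕ}

lemma mem_iff (c : Tate Fq s) (f : PowerSeries (Tate Fq s)) : f ∈ TateDisc c ↔
    Tendsto (fun i : ℕ => ‖PowerSeries.coeff i f‖ * ‖c‖ ^ i) atTop (𝓝 0) :=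
  PowerSeries.isRestricted_iff' ‖c‖ f

lemma summable_eval (c : Tate Fq s) (f : TateDisc c) :
    Summable fun i : ℕ => PowerSeries.coeff i f.1 * c ^ i := by
  refine NonarchimedeanAddGroup.summable_of_tendsto_cofinite_zero ?_
  rw [Nat.cofinite_eq_atTop]
  refine squeeze_zero_norm' ?_ ((mem_iff c f.1).1 f.2)
  filter_upwards [eventually_gt_atTop 0] with i hi
  exact (norm_mul_le _ _).trans
    (mul_le_mul_of_nonneg_left (norm_pow_le' c hi) (norm_nonneg _))

/-- Evaluation `f ↦ f|_{z = c}`; the series converges. -/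
def eval (c : Tate Fq s) (f : TateDisc c) : Tate Fq s :=
  ∑' i : ℕ, PowerSeries.coeff i f.1 * c ^ i

end TateDisc

namespace DrinfeldModule
variable {Fq} {s r : ℕ} (φ : DrinfeldModule Fq s r)

/-- The leading coefficient `A_r` as a unit of `𝕋_s`. -/
def leadingUnit : (Tate Fq s)ˣ := φ.isUnit_leading.unit

/-- The matrix `Φ` over `𝕋_s[z]` that represents multiplication by `σ = τ⁻¹` on the Frobenius
module `𝕋_s[σ]` in the `𝕋_s[z]`-basis `1, σ, …, σ^{r-1}`. Its first `r - 1` rows are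
`e_2, …, e_r` and its last row is
`[(z - θ) / A_r^{(-r)}, -A_1^{(-1)} / A_r^{(-r)}, …, -A_{r-1}^{(-(r-1))} / A_r^{(-r)}]`. -/
def Phi : Matrix (Fin r) (Fin r) (Polynomial (Tate Fq s)) := fun i j =>
  if (i : ℕ) + 1 < r then (if (j : ℕ) = i + 1 then 1 else 0)
  else if (j : ℕ) = 0 then
    Polynomial.C (Tate.twist (-(r : ℤ)) ↑φ.leadingUnit⁻¹) *
      (Polynomial.X - Polynomial.C (Tate.theta Fq s))
  else
    -Polynomial.C (Tate.twist (-(r : ℤ)) ↑φ.leadingUnit⁻¹ *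
      Tate.twist (-(j : ℤ)) (φ.coeff ⟨(j : ℕ) - 1, by omega⟩))

/-- `Φ` as a matrix over `𝕋_s[[z]]`. -/
def PhiSeries : Matrix (Fin r) (Fin r) (PowerSeries (Tate Fq s)) :=
  φ.Phi.map Polynomial.toPowerSeries

/-- The twist `f^{(-1)}` of `f ∈ 𝕋_s[[z]]`, applied to the coefficients of the powers of `z`.
(The ring `𝕋_s{z/θ}` is not stable under it, so that equations between twists are read in
`𝕋_s[[z]]`.) -/
def invTwist (f : PowerSeries (Tate Fq s)) : PowerSeries (Tate Fq s) :=
  PowerSeries.map (Tate.twist (-1) : Tate Fq s ≃+* Tate Fq s).toRingHom f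

/-- `Ψ ∈ GL_r(𝕋_s{z/θ})` gives a rigid analytic trivialization of `φ`: `Ψ^{(-1)} = Φ Ψ`. -/
def IsRigidAnalyticTrivialization (Ψ : Matrix.GeneralLinearGroup (Fin r)
    (TateDisc (Tate.theta Fq s))) : Prop :=
  Ψ.val.map (fun f => invTwist f.1) = φ.PhiSeries * Ψ.val.map (fun f => f.1)

/-- `V_φ`: the row vectors `g` over `𝕋_s{z/θ}` with `g^{(-1)} Φ = g`. -/
def V : Set (Fin r → TateDisc (Tate.theta Fq s)) :=
  {g | Matrix.vecMul (fun j => invTwist (g j).1) φ.PhiSeries = fun j => (g j).1}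

/-- The map `D_0`, `g = [g_1, …, g_r] ↦ g_1|_{z = θ}`, on row vectors over `𝕋_s{z/θ}`. -/
def D0 (g : Fin r → TateDisc (Tate.theta Fq s)) : Tate Fq s :=
  TateDisc.eval (Tate.theta Fq s) (g ⟨0, φ.rank_pos⟩)

end DrinfeldModule

end

end

end TateDrinfeld

open TateDrinfeld

/-! Solutions of `g^{(-1)} Φ = g` correspond to division towers. Put `h = g_r^{(-1)} / A_r^{(-r)}`.
The columns of `Φ` determine every entry of `g` from `h`: reading them upwards from the last entry
gives `g_1 = φ_θ(h) - θ h`, while the first column says `g_1 = (z - θ) h`. Hence `φ_θ(h) = z h`,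
that is, `φ_θ(h_0) = 0` and `φ_θ(h_{n+1}) = h_n`. Evaluating `(z - θ) h` at `z = θ` telescopes to
`D_0(g) = -lim θ^{n+1} h_n` (`tendsto_tower`).

Two estimates then control `D_0`. Near zero `φ_θ` enlarges norms by a factor at most `q`, so `φ_θ^n`
sends a sequence that is `o(q^{-n})` to a null sequence; and `exp_φ(f) = f + O(‖f‖^2)`. If the limit
vanishes, `h_m = φ_θ^n(h_{m+n})` tends to `0`, which gives injectivity. If the limit is `f`, then
`h_{n-1}` and `exp_φ(f / θ^n)` differ by `o(q^{-n})`; since `φ_θ^n` sends the first to `0` and the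
second to `exp_φ(f)`, `f` is a period. Conversely, a period `l` yields the tower `-exp_φ(l /
θ^{n+1})`, the negated Anderson generating function, which gives surjectivity.

For freeness, `(gΨ)^{(-1)} = g^{(-1)} Φ Ψ`, so `g` lies in `V_φ` exactly when `gΨ` is fixed by the
twist. Fixed series have coefficients in `𝔽_q`, where nonzero elements have norm one; convergence
leaves only polynomials in `z` and `t`. Thus `V_φ` consists of the vectors `c Ψ⁻¹` with `c`
polynomial, and `z ↦ θ` turns this into an `A[t_s]`-basis of the period lattice. -/

namespace TateDrinfeld

noncomputable section

open Filter Topology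

/-! ### Powers of `θ` and the Gauss norm. -/

namespace Tate
variable {Fq : Type*} [Field Fq] [Fintype Fq] {s : ℕ}

lemma one_lt_card : (1 : ℝ) < Fintype.card Fq := by
  exact_mod_cast Fintype.one_lt_card

lemma theta_ne_zero : CInfty.theta Fq ≠ 0 := by
  rw [← norm_ne_zero_iff, CInfty.norm_theta]
  exact (one_pos.trans one_lt_card).ne'

variable (Fq s) in
/-- The constant `θ ^ n` of the Tate algebra, for `n ∈ ℤ`. -/
def thetaPow (n : ℤ) : Tate Fq s := C Fq s (CInfty.theta Fq ^ n)

lemma norm_thetaPow (n : ℤ) : ‖thetaPow Fq s n‖ = (Fintype.card Fq : ℝ) ^ n := by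
  rw [thetaPow, norm_C, norm_zpow, CInfty.norm_theta]

lemma thetaPow_add (m n : ℤ) :
    thetaPow Fq s (m + n) = thetaPow Fq s m * thetaPow Fq s n := by
  rw [thetaPow, zpow_add₀ theta_ne_zero, map_mul, thetaPow, thetaPow]

lemma thetaPow_natCast (n : ℕ) : thetaPow Fq s n = theta Fq s ^ n := by
  rw [thetaPow, zpow_natCast, map_pow, theta]

lemma thetaPow_zero : thetaPow Fq s 0 = 1 := by
  rw [thetaPow, zpow_zero, map_one]

lemma thetaPow_one : thetaPow Fq s 1 = theta Fq s := by
  rw [thetaPow, zpow_one, theta]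

lemma theta_pow_mul_thetaPow_neg (n : ℕ) (f : Tate Fq s) :
    theta Fq s ^ n * (thetaPow Fq s (-n) * f) = f := by
  rw [← thetaPow_natCast, ← mul_assoc, ← thetaPow_add, add_neg_cancel, thetaPow_zero, one_mul]

/-- Submultiplicativity suffices, because it applies to `θ ^ n` and to its inverse, whose norms are
inverse to each other. -/
lemma norm_thetaPow_mul (n : ℤ) (f : Tate Fq s) :
    ‖thetaPow Fq s n * f‖ = (Fintype.card Fq : ℝ) ^ n * ‖f‖ := by
  have hq : (0 : ℝ) < Fintype.card Fq := one_pos.trans one_lt_card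
  have key (m : ℤ) (g : Tate Fq s) :
      ‖thetaPow Fq s m * g‖ ≤ (Fintype.card Fq : ℝ) ^ m * ‖g‖ :=
    (norm_mul_le _ _).trans_eq (by rw [norm_thetaPow])
  refine le_antisymm (key n f) ?_
  have h := key (-n) (thetaPow Fq s n * f)
  rw [← mul_assoc, ← thetaPow_add, neg_add_cancel, thetaPow_zero, one_mul, zpow_neg] at h
  rwa [← le_inv_mul_iff₀ (by positivity)]

lemma norm_theta_pow_mul (n : ℕ) (f : Tate Fq s) :
    ‖theta Fq s ^ n * f‖ = (Fintype.card Fq : ℝ) ^ n * ‖f‖ := by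
  rw [← thetaPow_natCast, norm_thetaPow_mul, zpow_natCast]

lemma norm_thetaPow_neg_mul (n : ℕ) (f : Tate Fq s) :
    ‖thetaPow Fq s (-n) * f‖ = ((Fintype.card Fq : ℝ)⁻¹) ^ n * ‖f‖ := by
  rw [norm_thetaPow_mul, zpow_neg, zpow_natCast, inv_pow]

lemma tendsto_thetaPow_neg_mul (f : Tate Fq s) :
    Tendsto (fun n : ℕ => ‖thetaPow Fq s (-n) * f‖) atTop (𝓝 0) := by
  simp only [norm_thetaPow_neg_mul]
  simpa using (tendsto_pow_atTop_nhds_zero_of_lt_one (by positivity)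
    (inv_lt_one_of_one_lt₀ (one_lt_card (Fq := Fq)))).mul_const ‖f‖

end Tate

/-! ### Growth of `φ_θ` and `exp_φ` near zero; division towers. -/

namespace DrinfeldModule
variable {Fq : Type*} [Field Fq] [Fintype Fq] {s r : ℕ} (φ : DrinfeldModule Fq s r)

open Tate

lemma phiTheta_add (f g : Tate Fq s) : φ.phiTheta (f + g) = φ.phiTheta f + φ.phiTheta g := by
  simp only [phiTheta, map_add, mul_add, Finset.sum_add_distrib]
  ring

lemma phiTheta_neg (f : Tate Fq s) : φ.phiTheta (-f) = -φ.phiTheta f := by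
  simp only [phiTheta, map_neg, mul_neg, Finset.sum_neg_distrib]
  ring

/-- The twisted terms are at least quadratic in `‖f‖`, so on a small ball the linear term bound `q
‖f‖` dominates them. -/
lemma exists_norm_phiTheta_le : ∃ ε > 0, ∀ f : Tate Fq s, ‖f‖ ≤ ε →
    ‖φ.phiTheta f‖ ≤ Fintype.card Fq * ‖f‖ := by
  have hq1 : (1 : ℝ) < Fintype.card Fq := one_lt_card
  obtain ⟨B, hB⟩ := (Set.finite_range fun k : Fin r => ‖φ.coeff k‖).bddAbove
  set M := max B 1
  have hM1 : 1 ≤ M := le_max_right _ _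
  have hMk : ∀ k, ‖φ.coeff k‖ ≤ M := fun k => (hB ⟨k, rfl⟩).trans (le_max_left _ _)
  refine ⟨M⁻¹, by positivity, fun f hf => ?_⟩
  have hf1 : ‖f‖ ≤ 1 := hf.trans (inv_le_one_of_one_le₀ hM1)
  have hMf : M * ‖f‖ ≤ 1 := by
    calc M * ‖f‖ ≤ M * M⁻¹ := by gcongr
      _ = 1 := mul_inv_cancel₀ (by positivity)
  refine (IsUltrametricDist.norm_add_le_max _ _).trans (max_le ?_ ?_)
  · exact (norm_mul_le _ _).trans_eq (by rw [norm_theta])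
  refine IsUltrametricDist.norm_sum_le_of_forall_le_of_nonneg (by positivity) fun k _ => ?_
  have tw : ‖twist ((k : ℤ) + 1) f‖ ≤ ‖f‖ ^ (Fintype.card Fq ^ ((k : ℕ) + 1)) := by
    exact_mod_cast norm_twist_le ((k : ℕ) + 1) f
  calc ‖φ.coeff k * twist ((k : ℤ) + 1) f‖ ≤ M * ‖f‖ ^ (Fintype.card Fq ^ ((k : ℕ) + 1)) :=
        (norm_mul_le _ _).trans (mul_le_mul (hMk k) tw (norm_nonneg _) (by positivity))
    _ ≤ M * ‖f‖ ^ 2 := by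
        gcongr ?_ * ?_
        exact pow_le_pow_of_le_one (norm_nonneg _) hf1
          (Nat.one_lt_pow (by omega) Fintype.one_lt_card)
    _ = (M * ‖f‖) * ‖f‖ := by ring
    _ ≤ Fintype.card Fq * ‖f‖ := by gcongr; exact hMf.trans hq1.le

/-- The smallness condition carries the factor `q ^ n` so that all intermediate iterates stay in the
ball where the one-step bound holds. -/
lemma exists_norm_iterate_phiTheta_le : ∃ ε > 0, ∀ (n : ℕ) (f : Tate Fq s),
    (Fintype.card Fq : ℝ) ^ n * ‖f‖ ≤ ε →
      ‖φ.phiTheta^[n] f‖ ≤ (Fintype.card Fq : ℝ) ^ n * ‖f‖ := by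
  obtain ⟨ε, hε, h⟩ := φ.exists_norm_phiTheta_le
  have hq1 : (1 : ℝ) < Fintype.card Fq := one_lt_card
  refine ⟨ε, hε, fun n f => ?_⟩
  induction n with
  | zero => simp
  | succ n ih =>
    intro hf
    have h1 : (Fintype.card Fq : ℝ) ^ n * ‖f‖ ≤ ε := by
      refine le_trans ?_ hf
      gcongr
      · exact hq1.le
      · omega
    rw [Function.iterate_succ_apply', pow_succ', mul_assoc]
    exact (h _ ((ih h1).trans h1)).trans (mul_le_mul_of_nonneg_left (ih h1) (by positivity))

lemma tendsto_iterate_phiTheta {f : ℕ → Tate Fq s}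
    (hf : Tendsto (fun n => (Fintype.card Fq : ℝ) ^ n * ‖f n‖) atTop (𝓝 0)) :
    Tendsto (fun n => φ.phiTheta^[n] (f n)) atTop (𝓝 0) := by
  obtain ⟨ε, hε, h⟩ := φ.exists_norm_iterate_phiTheta_le
  refine squeeze_zero_norm' ?_ hf
  filter_upwards [hf.eventually (ge_mem_nhds hε)] with n hn
  exact h n _ hn

/-- The term of index `n ≥ 1` involves `‖f‖ ^ (q ^ n)`, and `q ^ n ≥ 2`. -/
lemma exists_norm_exp_sub_le : ∃ ε > 0, ∃ c : ℝ, ∀ f : Tate Fq s, ‖f‖ ≤ ε →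
    ‖φ.exp f - f‖ ≤ c * ‖f‖ ^ 2 := by
  obtain ⟨M, ρ, hM, hρ0, hρ1, h⟩ := φ.exists_norm_expCoeff_le
  -- The radius ensures `M ‖f‖ ≤ 1`; the added `1` covers `M = 0`.
  refine ⟨(M + 1)⁻¹, by positivity, M ^ 2, fun f hf => ?_⟩
  have hMf : M * ‖f‖ ≤ 1 := by
    calc M * ‖f‖ ≤ (M + 1) * (M + 1)⁻¹ := by gcongr; linarith
      _ = 1 := mul_inv_cancel₀ (by positivity)
  have hs := φ.summable_exp f
  have e : φ.exp f - f = ∑' n : ℕ, φ.expCoeff (n + 1) * twist ((n + 1 : ℕ) : ℤ) f := by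
    rw [exp, hs.tsum_eq_zero_add, expCoeff_zero]
    simp [twist]
  rw [e]
  refine (IsUltrametricDist.norm_tsum_le _).trans (ciSup_le fun n => ?_)
  calc ‖φ.expCoeff (n + 1) * twist ((n + 1 : ℕ) : ℤ) f‖
      ≤ (M * ρ ^ (n + 1)) ^ (Fintype.card Fq ^ (n + 1)) * ‖f‖ ^ (Fintype.card Fq ^ (n + 1)) :=
        (norm_mul_le _ _).trans (mul_le_mul (h _) (norm_twist_le _ f) (norm_nonneg _)
          (by positivity))
    _ = (M * ρ ^ (n + 1) * ‖f‖) ^ (Fintype.card Fq ^ (n + 1)) := by rw [← mul_pow]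
    _ ≤ (M * ‖f‖) ^ (Fintype.card Fq ^ (n + 1)) := by
        gcongr
        exact mul_le_of_le_one_right hM (pow_le_one₀ hρ0.le hρ1.le)
    _ ≤ (M * ‖f‖) ^ 2 := pow_le_pow_of_le_one (by positivity) hMf
        (Nat.one_lt_pow (by omega) Fintype.one_lt_card)
    _ = M ^ 2 * ‖f‖ ^ 2 := mul_pow _ _ _

/-- A `φ_θ`-division tower of zero: the coefficients of a power series `h` in `z` with
`φ_θ(h) = z h`. -/
structure IsDivisionTower (h : ℕ → Tate Fq s) : Prop where
  zero : φ.phiTheta (h 0) = 0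
  succ : ∀ n, φ.phiTheta (h (n + 1)) = h n

variable {φ}

lemma IsDivisionTower.iterate {h : ℕ → Tate Fq s} (hh : φ.IsDivisionTower h) (m n : ℕ) :
    φ.phiTheta^[n] (h (m + n)) = h m := by
  induction n with
  | zero => rfl
  | succ n ih => rw [Function.iterate_succ_apply, ← add_assoc, hh.succ, ih]

lemma IsDivisionTower.iterate_self {h : ℕ → Tate Fq s} (hh : φ.IsDivisionTower h) (n : ℕ) :
    φ.phiTheta^[n + 1] (h n) = 0 := by
  rw [Function.iterate_succ_apply', ← hh.zero, ← hh.iterate 0 n, zero_add]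

/-- A division tower whose `n`-th member is `o(q ^ (-n))` vanishes. -/
lemma IsDivisionTower.eq_zero {h : ℕ → Tate Fq s} (hh : φ.IsDivisionTower h)
    (ht : Tendsto (fun n => h n * theta Fq s ^ (n + 1)) atTop (𝓝 0)) : h = 0 := by
  funext m
  -- Every `φ_θ^n (h (m + n))` equals `h m`, so the sequence that tends to zero is constant.
  have h1 := φ.tendsto_iterate_phiTheta (f := fun n => h (m + n)) <| by
    refine squeeze_zero (fun n => by positivity) (fun n => ?_)
      ((tendsto_zero_iff_norm_tendsto_zero.1 ht).comp (tendsto_add_atTop_nat m))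
    rw [Function.comp, mul_comm (h _), norm_theta_pow_mul, add_comm m n]
    gcongr
    · exact one_lt_card.le
    · omega
  simp only [hh.iterate] at h1
  exact tendsto_nhds_unique tendsto_const_nhds h1

/-! ### Anderson generating functions. -/

variable (φ)

lemma phiTheta_iterate_add (n : ℕ) (f g : Tate Fq s) :
    φ.phiTheta^[n] (f + g) = φ.phiTheta^[n] f + φ.phiTheta^[n] g := by
  induction n generalizing f g with
  | zero => rfl
  | succ n ih => simp only [Function.iterate_succ_apply, phiTheta_add, ih]

lemma exp_theta_pow_mul (n : ℕ) (f : Tate Fq s) :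
    φ.exp (theta Fq s ^ n * f) = φ.phiTheta^[n] (φ.exp f) := by
  induction n with
  | zero => simp
  | succ n ih => rw [pow_succ', mul_assoc, exp_theta_mul, ih, Function.iterate_succ_apply']

/-- The quadratic error of `exp_φ` at `f / θ ^ n` is `O(q ^ (-2n))`, which still tends to zero after
multiplication by `θ ^ n`. -/
lemma tendsto_theta_pow_mul_exp (f : Tate Fq s) :
    Tendsto (fun n : ℕ => theta Fq s ^ n * φ.exp (thetaPow Fq s (-n) * f)) atTop (𝓝 f) := by
  obtain ⟨ε, hε, c, h⟩ := φ.exists_norm_exp_sub_le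
  rw [tendsto_iff_norm_sub_tendsto_zero]
  have ht := (tendsto_thetaPow_neg_mul f).mul_const (c * ‖f‖)
  rw [zero_mul] at ht
  refine squeeze_zero' (.of_forall fun n => norm_nonneg _) ?_ ht
  filter_upwards [(tendsto_thetaPow_neg_mul f).eventually (ge_mem_nhds hε)] with n hn
  have e : theta Fq s ^ n * φ.exp (thetaPow Fq s (-n) * f) - f =
      theta Fq s ^ n * (φ.exp (thetaPow Fq s (-n) * f) - thetaPow Fq s (-n) * f) := by
    rw [mul_sub, theta_pow_mul_thetaPow_neg]
  have e' := norm_theta_pow_mul n (thetaPow Fq s (-n) * f)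
  rw [theta_pow_mul_thetaPow_neg] at e'
  rw [e, norm_theta_pow_mul, e']
  refine (mul_le_mul_of_nonneg_left (h _ hn) (by positivity)).trans_eq ?_
  ring

/-- The coefficients `exp_φ(f / θ ^ (n + 1))` of the Anderson generating function of `f`. -/
def andersonCoeff (f : Tate Fq s) (n : ℕ) : Tate Fq s :=
  φ.exp (thetaPow Fq s (-(n + 1 : ℕ)) * f)

lemma tendsto_andersonCoeff (f : Tate Fq s) :
    Tendsto (fun n => φ.andersonCoeff f n * theta Fq s ^ (n + 1)) atTop (𝓝 f) := by
  simpa only [andersonCoeff, mul_comm, Function.comp_def] using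
    (φ.tendsto_theta_pow_mul_exp f).comp (tendsto_add_atTop_nat 1)

lemma phiTheta_andersonCoeff_succ (f : Tate Fq s) (n : ℕ) :
    φ.phiTheta (φ.andersonCoeff f (n + 1)) = φ.andersonCoeff f n := by
  rw [andersonCoeff, ← exp_theta_mul, ← mul_assoc, ← thetaPow_one, ← thetaPow_add,
    andersonCoeff]
  congr 3

lemma isDivisionTower_andersonCoeff {f : Tate Fq s} (hf : φ.exp f = 0) :
    φ.IsDivisionTower (φ.andersonCoeff f) where
  zero := by
    rw [andersonCoeff, ← exp_theta_mul, ← mul_assoc, ← thetaPow_one, ← thetaPow_add]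
    simp [thetaPow_zero, hf]
  succ := φ.phiTheta_andersonCoeff_succ f

variable {φ}

/-- The limit of `h n * θ ^ (n + 1)` along a division tower is a period. -/
lemma IsDivisionTower.exp_eq_zero {h : ℕ → Tate Fq s} (hh : φ.IsDivisionTower h) {f : Tate Fq s}
    (ht : Tendsto (fun n => h n * theta Fq s ^ (n + 1)) atTop (𝓝 f)) : φ.exp f = 0 := by
  -- Both terms are `θ ^ (-n) f` up to `o(q ^ (-n))`. The truncated value of `n - 1` at `n = 0` is
  -- harmless, since the sequence is shifted by one afterwards.
  have h1 := φ.tendsto_iterate_phiTheta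
    (f := fun n => φ.exp (thetaPow Fq s (-n) * f) - h (n - 1)) <| by
    simp only [← norm_theta_pow_mul, ← tendsto_zero_iff_norm_tendsto_zero]
    rw [← tendsto_add_atTop_iff_nat 1]
    simpa [mul_sub, andersonCoeff, mul_comm] using (φ.tendsto_andersonCoeff f).sub ht
  refine tendsto_nhds_unique (tendsto_const_nhds.congr fun n => ?_)
    (h1.comp (tendsto_add_atTop_nat 1))
  -- As `φ_θ^{n+1}` kills `h n`, the iterate of the difference is `exp_φ(f)` for every `n`.
  have e := φ.phiTheta_iterate_add (n + 1)
    (φ.exp (thetaPow Fq s (-(n + 1 : ℕ)) * f) - h n) (h n)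
  rw [sub_add_cancel, ← exp_theta_pow_mul, theta_pow_mul_thetaPow_neg, hh.iterate_self,
    add_zero] at e
  exact e

end DrinfeldModule

/-! ### Evaluation at `z = c` as a ring homomorphism. -/

lemma tsum_coeff_mul_mul_pow {R : Type*} [NormedCommRing R] [IsUltrametricDist R]
    [CompleteSpace R] {f g : PowerSeries R} {c : R}
    (hf : Summable fun i : ℕ => PowerSeries.coeff i f * c ^ i)
    (hg : Summable fun i : ℕ => PowerSeries.coeff i g * c ^ i) :
    ∑' i : ℕ, PowerSeries.coeff i (f * g) * c ^ i =
      (∑' i : ℕ, PowerSeries.coeff i f * c ^ i) * ∑' i : ℕ, PowerSeries.coeff i g * c ^ i := by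
  have : NonarchimedeanRing R := ⟨NonarchimedeanAddGroup.is_nonarchimedean⟩
  have hfg := hf.mul_of_nonarchimedean hg
  rw [hf.tsum_mul_tsum_eq_tsum_sum_antidiagonal hg hfg]
  refine tsum_congr fun n => ?_
  rw [PowerSeries.coeff_mul, Finset.sum_mul]
  refine Finset.sum_congr rfl fun p hp => ?_
  rw [← Finset.HasAntidiagonal.mem_antidiagonal.1 hp, pow_add]
  exact mul_mul_mul_comm _ _ _ _

namespace TateDisc
variable {Fq : Type*} [Field Fq] [Fintype Fq] {s : ℕ} (c : Tate Fq s)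

lemma eval_add (f g : TateDisc c) : eval c (f + g) = eval c f + eval c g := by
  simp only [eval, Subring.coe_add, map_add, add_mul]
  exact (summable_eval c f).tsum_add (summable_eval c g)

lemma eval_mul (f g : TateDisc c) : eval c (f * g) = eval c f * eval c g :=
  tsum_coeff_mul_mul_pow (summable_eval c f) (summable_eval c g)

/-- The element of `𝕋_s{z/c}` that is given by a constant. -/
def const : Tate Fq s →+* TateDisc c :=
  PowerSeries.C.codRestrict _ fun a => PowerSeries.isRestricted_C _ a

/-- The variable `z` of `𝕋_s{z/c}`. -/
def var : TateDisc c :=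
  ⟨PowerSeries.X, PowerSeries.isRestricted_monomial _ 1 1⟩

lemma coe_const (a : Tate Fq s) : (const c a).1 = PowerSeries.C a := rfl

lemma coe_var : (var c).1 = PowerSeries.X := rfl

lemma eval_const (a : Tate Fq s) : eval c (const c a) = a := by
  rw [eval, tsum_eq_single 0]
  · simp [coe_const]
  · intro n hn
    simp [coe_const, PowerSeries.coeff_C, hn]

lemma eval_var : eval c (var c) = c := by
  rw [eval, tsum_eq_single 1]
  · simp [coe_var]
  · intro n hn
    simp [coe_var, PowerSeries.coeff_X, hn]

/-- Evaluation at `z = c` as a ring homomorphism. -/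
def evalHom : TateDisc c →+* Tate Fq s where
  toFun := eval c
  map_one' := by rw [← map_one (const c), eval_const]
  map_zero' := by rw [← map_zero (const c), eval_const]
  map_mul' := eval_mul c
  map_add' := eval_add c

end TateDisc

/-! ### From solutions of `g^{(-1)} Φ = g` to division towers. -/

namespace DrinfeldModule
variable {Fq : Type*} [Field Fq] [Fintype Fq] {s r : ℕ} (φ : DrinfeldModule Fq s r)

open Tate

lemma coeff_invTwist (n : ℕ) (f : PowerSeries (Tate Fq s)) :
    PowerSeries.coeff n (invTwist f) = twist (-1) (PowerSeries.coeff n f) := by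
  rw [invTwist, PowerSeries.coeff_map]
  rfl

lemma invTwist_sub (f g : PowerSeries (Tate Fq s)) :
    invTwist (f - g) = invTwist f - invTwist g := map_sub _ _ _

/-- The last index of a row vector of length `r`. -/
def lastIndex : Fin r := ⟨r - 1, Nat.sub_lt φ.rank_pos one_pos⟩

/-- The first index of a row vector of length `r`. -/
def firstIndex : Fin r := ⟨0, φ.rank_pos⟩

/-- The element `1 / A_r^{(-r)}`. -/
def leadingInvTwist : Tate Fq s := twist (-(r : ℤ)) ↑φ.leadingUnit⁻¹

lemma leadingInvTwist_mul : φ.leadingInvTwist * twist (-(r : ℤ)) (φ.coeff φ.lastIndex) = 1 := by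
  have h : (↑φ.leadingUnit⁻¹ : Tate Fq s) * φ.coeff φ.lastIndex = 1 := φ.leadingUnit.inv_mul
  rw [leadingInvTwist, ← map_mul, h, map_one]

/-- Only the last row of `Φ` meets the first column. For `g` in `V_φ` this reads `g_1 = (z - θ) h`.
-/
lemma vecMul_PhiSeries_first (x : Fin r → PowerSeries (Tate Fq s)) :
    Matrix.vecMul x φ.PhiSeries φ.firstIndex =
      (PowerSeries.X - PowerSeries.C (theta Fq s)) *
        (PowerSeries.C φ.leadingInvTwist * x φ.lastIndex) := by
  rw [Matrix.vecMul, dotProduct, Finset.sum_eq_single φ.lastIndex]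
  · have hr : ¬ (r - 1 + 1 < r) := by omega
    simp [PhiSeries, Phi, lastIndex, firstIndex, hr, leadingInvTwist]
    ring
  · intro i _ hi
    have hi' : (i : ℕ) + 1 < r := by
      have := Fin.val_ne_of_ne hi
      simp only [lastIndex] at this
      omega
    simp [PhiSeries, Phi, firstIndex, hi']
  · simp

lemma vecMul_PhiSeries_succ (x : Fin r → PowerSeries (Tate Fq s)) (j : ℕ) (hj : j + 1 < r) :
    Matrix.vecMul x φ.PhiSeries ⟨j + 1, hj⟩ =
      x ⟨j, by omega⟩ - PowerSeries.C (twist (-((j : ℤ) + 1)) (φ.coeff ⟨j, by omega⟩)) *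
        (PowerSeries.C φ.leadingInvTwist * x φ.lastIndex) := by
  rw [Matrix.vecMul, dotProduct, Finset.sum_eq_add (⟨j, by omega⟩ : Fin r) φ.lastIndex]
  · have hr : ¬ (r - 1 + 1 < r) := by omega
    simp [PhiSeries, Phi, lastIndex, hr, hj, leadingInvTwist]
    ring
  · simp only [lastIndex, ne_eq, Fin.mk.injEq]
    omega
  · intro i _ hi
    have h1 : (i : ℕ) ≠ j := fun h => hi.1 (Fin.ext h)
    have h2 : (i : ℕ) + 1 < r := by
      have := Fin.val_ne_of_ne hi.2
      simp only [lastIndex] at this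
      omega
    simp [PhiSeries, Phi, h2, h1.symm]
  · simp
  · simp

/-- The power series `h = g_r^{(-1)} / A_r^{(-r)}` that is attached to a row vector `g`. -/
def tower (g : Fin r → TateDisc (theta Fq s)) (n : ℕ) : Tate Fq s :=
  φ.leadingInvTwist * twist (-1) (PowerSeries.coeff n (g φ.lastIndex).1)

variable {φ} in
lemma coeff_zero_first_of_mem_V {g : Fin r → TateDisc (theta Fq s)} (hg : g ∈ φ.V) :
    PowerSeries.coeff 0 (g φ.firstIndex).1 = -(theta Fq s * φ.tower g 0) := by
  rw [← congrFun hg φ.firstIndex, vecMul_PhiSeries_first]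
  simp only [sub_mul, map_sub, PowerSeries.coeff_zero_X_mul, PowerSeries.coeff_C_mul,
    coeff_invTwist, tower, zero_sub]

variable {φ} in
lemma coeff_succ_first_of_mem_V {g : Fin r → TateDisc (theta Fq s)} (hg : g ∈ φ.V) (n : ℕ) :
    PowerSeries.coeff (n + 1) (g φ.firstIndex).1 =
      φ.tower g n - theta Fq s * φ.tower g (n + 1) := by
  rw [← congrFun hg φ.firstIndex, vecMul_PhiSeries_first]
  simp only [sub_mul, map_sub, PowerSeries.coeff_succ_X_mul, PowerSeries.coeff_C_mul,
    coeff_invTwist, tower]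

variable {φ} in
lemma coeff_succ_of_mem_V {g : Fin r → TateDisc (theta Fq s)} (hg : g ∈ φ.V) (n j : ℕ)
    (hj : j + 1 < r) : PowerSeries.coeff n (g ⟨j + 1, hj⟩).1 =
      twist (-1) (PowerSeries.coeff n (g ⟨j, by omega⟩).1) -
        twist (-((j : ℤ) + 1)) (φ.coeff ⟨j, by omega⟩) * φ.tower g n := by
  rw [← congrFun hg ⟨j + 1, hj⟩, vecMul_PhiSeries_succ]
  simp only [map_sub, PowerSeries.coeff_C_mul, coeff_invTwist, tower]

/-- The `n`-th coefficient of the `j`-th entry of the solution of `g^{(-1)} Φ = g` that is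
determined by `h`. -/
def solutionCoeff (h : ℕ → Tate Fq s) (j : Fin r) (n : ℕ) : Tate Fq s :=
  ∑ k : Fin r, if j ≤ k then
    twist (-(j : ℤ)) (φ.coeff k) * twist ((k : ℤ) + 1 - j) (h n) else 0

/-- This is where `φ_θ` enters: at the first index the sum is `φ_θ` without its linear term. -/
lemma solutionCoeff_first (h : ℕ → Tate Fq s) (n : ℕ) :
    φ.solutionCoeff h φ.firstIndex n = φ.phiTheta (h n) - theta Fq s * h n := by
  rw [phiTheta, add_sub_cancel_left]
  refine Finset.sum_congr rfl fun k _ => ?_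
  rw [if_pos (Fin.le_def.2 (Nat.zero_le _))]
  simp [firstIndex, twist]

lemma solutionCoeff_last (h : ℕ → Tate Fq s) (n : ℕ) :
    φ.solutionCoeff h φ.lastIndex n =
      twist (1 - (r : ℤ)) (φ.coeff φ.lastIndex) * twist 1 (h n) := by
  have hr := φ.rank_pos
  rw [solutionCoeff, Finset.sum_eq_single φ.lastIndex, if_pos le_rfl]
  · congr 2
    · congr 1
      simp only [lastIndex]
      omega
    · congr 1
      ring
  · intro k _ hk
    refine if_neg fun h' => hk (le_antisymm ?_ h')
    rw [Fin.le_def]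
    simp only [lastIndex]
    omega
  · simp

/-- After the inverse twist, the summand `k = j` loses its twist on `h` and becomes the subtracted
term; the summands `k > j` agree on both sides. -/
lemma solutionCoeff_succ (h : ℕ → Tate Fq s) (n j : ℕ) (hj : j + 1 < r) :
    φ.solutionCoeff h ⟨j + 1, hj⟩ n = twist (-1) (φ.solutionCoeff h ⟨j, by omega⟩ n) -
      twist (-((j : ℤ) + 1)) (φ.coeff ⟨j, by omega⟩) * h n := by
  rw [eq_sub_iff_add_eq, solutionCoeff, solutionCoeff, map_sum,
    ← Finset.add_sum_erase _ _ (Finset.mem_univ (⟨j, by omega⟩ : Fin r)),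
    ← Finset.add_sum_erase _ (fun k => twist _ _)
      (Finset.mem_univ (⟨j, by omega⟩ : Fin r))]
  rw [if_neg (by simp), if_pos le_rfl, zero_add, add_comm]
  congr 1
  · simp only [map_mul, twist_twist]
    congr 2
    · congr 1
      ring
    · have e : -1 + ((j : ℤ) + 1 - j) = 0 := by ring
      simp only [e]
      simp [twist]
  · refine Finset.sum_congr rfl fun k hk => ?_
    have hk' : (k : ℕ) ≠ j := fun h => (Finset.mem_erase.1 hk).1 (Fin.ext h)
    by_cases hjk : j + 1 ≤ (k : ℕ)
    · rw [if_pos (Fin.le_def.2 hjk), if_pos (by rw [Fin.le_def]; simp only; omega), map_mul, twist_twist,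
        twist_twist]
      push_cast
      congr 2
      · congr 1
        ring
      · congr 1
        ring
    · rw [if_neg (fun h => hjk (Fin.le_def.1 h)), if_neg (by rw [Fin.le_def]; simp only; omega), map_zero]

variable {φ} in
lemma coeff_eq_solutionCoeff {g : Fin r → TateDisc (theta Fq s)} (hg : g ∈ φ.V) (j : Fin r)
    (n : ℕ) : PowerSeries.coeff n (g j).1 = φ.solutionCoeff (φ.tower g) j n := by
  obtain ⟨j, hj⟩ := j
  have hr := φ.rank_pos
  -- Descent from the last entry, which `h` determines by definition: column `j + 1` expresses
  -- `g_j^{(-1)}` through `g_{j+1}` and `h`, and the twist is injective.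
  refine Nat.decreasingInduction' (P := fun j => ∀ hj : j < r,
    PowerSeries.coeff n (g ⟨j, hj⟩).1 = φ.solutionCoeff (φ.tower g) ⟨j, hj⟩ n)
    (n := r - 1) ?_ (by omega) ?_ hj
  · intro k hk _ ih hkr
    have h1 := ih (by omega)
    rw [coeff_succ_of_mem_V hg, solutionCoeff_succ, sub_left_inj] at h1
    exact (twist (-1)).injective h1
  · intro _
    have h1 := φ.solutionCoeff_last (φ.tower g) n
    refine Eq.trans ?_ h1.symm
    rw [tower, map_mul, twist_twist, ← mul_assoc]
    have h2 := congrArg (twist (Fq := Fq) (s := s) 1) φ.leadingInvTwist_mul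
    rw [map_mul, twist_twist, map_one, ← sub_eq_add_neg, mul_comm] at h2
    rw [h2]
    simp [twist, lastIndex]

variable {φ} in
-- Compare the two expressions `(z - θ) h` and `φ_θ(h) - θ h` for the first entry.
lemma isDivisionTower_tower {g : Fin r → TateDisc (theta Fq s)} (hg : g ∈ φ.V) :
    φ.IsDivisionTower (φ.tower g) where
  zero := by
    have h := coeff_eq_solutionCoeff hg φ.firstIndex 0
    rw [coeff_zero_first_of_mem_V hg, solutionCoeff_first] at h
    linear_combination -h
  succ n := by
    have h := coeff_eq_solutionCoeff hg φ.firstIndex (n + 1)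
    rw [coeff_succ_first_of_mem_V hg, solutionCoeff_first] at h
    linear_combination -h

variable {φ} in
-- The partial sums of `g_1 = (z - θ) h` at `z = θ` telescope to `-h_n θ ^ (n + 1)`. The series `h`
-- itself need not converge there.
lemma tendsto_tower {g : Fin r → TateDisc (theta Fq s)} (hg : g ∈ φ.V) :
    Tendsto (fun n => φ.tower g n * theta Fq s ^ (n + 1)) atTop (𝓝 (-φ.D0 g)) := by
  have h := ((TateDisc.summable_eval _ (g φ.firstIndex)).hasSum.tendsto_sum_nat.comp
    (tendsto_add_atTop_nat 1)).neg
  refine h.congr fun n => ?_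
  rw [Function.comp, neg_eq_iff_eq_neg]
  induction n with
  | zero =>
    rw [zero_add, Finset.sum_range_one, coeff_zero_first_of_mem_V hg]
    ring
  | succ n ih =>
    rw [Finset.sum_range_succ, ih, coeff_succ_first_of_mem_V hg]
    ring

/-! ### Bijectivity of `D_0` onto the period lattice. -/

variable {φ} in
lemma sub_mem_V {f g : Fin r → TateDisc (theta Fq s)} (hf : f ∈ φ.V) (hg : g ∈ φ.V) :
    f - g ∈ φ.V := by
  funext j
  have h := congrArg₂ (· - ·) (congrFun hf j) (congrFun hg j)
  simp only [Matrix.vecMul, dotProduct, ← Finset.sum_sub_distrib, ← sub_mul,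
    ← invTwist_sub] at h
  exact h

variable {φ} in
lemma eq_zero_of_D0_eq_zero {g : Fin r → TateDisc (theta Fq s)} (hg : g ∈ φ.V)
    (h0 : φ.D0 g = 0) : g = 0 := by
  have ht := tendsto_tower hg
  rw [h0, neg_zero] at ht
  have h := (isDivisionTower_tower hg).eq_zero ht
  funext j
  refine Subtype.ext (PowerSeries.ext fun n => ?_)
  rw [coeff_eq_solutionCoeff hg, h]
  simp [solutionCoeff]

lemma D0_sub (f g : Fin r → TateDisc (theta Fq s)) : φ.D0 (f - g) = φ.D0 f - φ.D0 g :=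
  map_sub (TateDisc.evalHom (theta Fq s)) _ _

lemma mapsTo_D0 : Set.MapsTo φ.D0 φ.V (φ.periodLattice : Set (Tate Fq s)) := by
  intro g hg
  have h := (isDivisionTower_tower hg).exp_eq_zero (tendsto_tower hg)
  have e := φ.exp_add (φ.D0 g) (-φ.D0 g)
  rw [h, add_neg_cancel, exp_zero, add_zero] at e
  exact e.symm

lemma injOn_D0 : Set.InjOn φ.D0 φ.V := fun f hf g hg h =>
  sub_eq_zero.1 (eq_zero_of_D0_eq_zero (sub_mem_V hf hg) (by rw [D0_sub, h, sub_self]))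

/-- Positive twists of a series whose coefficients are `O(q ^ (-n))` converge at `z = θ`. -/
lemma tendsto_norm_twist_mul {h : ℕ → Tate Fq s} {l : Tate Fq s}
    (ht : Tendsto (fun n => h n * theta Fq s ^ (n + 1)) atTop (𝓝 l)) {m : ℕ} (hm : m ≠ 0) :
    Tendsto (fun n => ‖twist m (h n)‖ * ‖theta Fq s‖ ^ n) atTop (𝓝 0) := by
  have h1 : Tendsto (fun n => ‖h n * theta Fq s ^ (n + 1)‖) atTop (𝓝 ‖l‖) := ht.norm
  have hq : (1 : ℝ) < Fintype.card Fq := one_lt_card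
  have hn (n : ℕ) : ‖h n * theta Fq s ^ (n + 1)‖ = (Fintype.card Fq : ℝ) ^ (n + 1) * ‖h n‖ := by
    rw [mul_comm, norm_theta_pow_mul]
  have h2 : Tendsto (fun n => ‖h n‖) atTop (𝓝 0) := by
    have h3 := ((tendsto_pow_atTop_nhds_zero_of_lt_one (by positivity)
      (inv_lt_one_of_one_lt₀ hq)).comp (tendsto_add_atTop_nat 1)).mul h1
    rw [zero_mul] at h3
    refine h3.congr fun n => ?_
    rw [hn, Function.comp, inv_pow, inv_mul_cancel_left₀ (by positivity)]
  -- A positive twist at least squares a norm below one: one factor `‖h n‖` absorbs `q ^ (n + 1)`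
  -- and stays bounded, the other tends to zero.
  have h3 := h2.mul h1
  rw [zero_mul] at h3
  refine squeeze_zero' (.of_forall fun n => by positivity) ?_ h3
  filter_upwards [h2.eventually (ge_mem_nhds one_pos)] with n h4
  rw [hn, norm_theta]
  calc ‖twist m (h n)‖ * (Fintype.card Fq : ℝ) ^ n
      ≤ ‖h n‖ ^ 2 * (Fintype.card Fq : ℝ) ^ (n + 1) := by
        gcongr
        · exact (norm_twist_le m _).trans (pow_le_pow_of_le_one (norm_nonneg _) h4
            (Nat.one_lt_pow hm Fintype.one_lt_card))
        · exact hq.le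
        · omega
    _ = _ := by ring

lemma surjOn_D0 : Set.SurjOn φ.D0 φ.V (φ.periodLattice : Set (Tate Fq s)) := by
  intro l hl
  -- The sign compensates for `D_0` being minus the limit of `h n * θ ^ (n + 1)`.
  set h : ℕ → Tate Fq s := fun n => -φ.andersonCoeff l n with hdef
  have hh : φ.IsDivisionTower h := by
    have h1 := φ.isDivisionTower_andersonCoeff hl
    exact ⟨by rw [hdef, phiTheta_neg, h1.zero, neg_zero], fun n => by
      simp only [hdef, phiTheta_neg, h1.succ]⟩
  have ht : Tendsto (fun n => h n * theta Fq s ^ (n + 1)) atTop (𝓝 (-l)) := by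
    simpa [hdef] using (φ.tendsto_andersonCoeff l).neg
  -- Only twists of `h` by `k + 1 - j ≥ 1` occur, and these converge at `z = θ` even when `h` does
  -- not.
  have hmem (j : Fin r) : PowerSeries.mk (φ.solutionCoeff h j) ∈ TateDisc (theta Fq s) := by
    have e : PowerSeries.mk (φ.solutionCoeff h j) = ∑ k : Fin r, if j ≤ k then
        PowerSeries.C (twist (-(j : ℤ)) (φ.coeff k)) *
          PowerSeries.mk fun n => twist ((k : ℤ) + 1 - j) (h n) else 0 := by
      ext1 n
      rw [PowerSeries.coeff_mk, map_sum, solutionCoeff]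
      refine Finset.sum_congr rfl fun k _ => ?_
      split_ifs
      · rw [PowerSeries.coeff_C_mul, PowerSeries.coeff_mk]
      · rw [map_zero]
    rw [e]
    refine Subring.sum_mem _ fun k _ => ?_
    split_ifs with hjk
    · refine Subring.mul_mem _ (PowerSeries.isRestricted_C _ _) ?_
      rw [TateDisc.mem_iff]
      have hm : (k : ℤ) + 1 - j = ((k + 1 - j : ℕ) : ℤ) := by
        have := Fin.le_def.1 hjk
        omega
      simp only [PowerSeries.coeff_mk, hm]
      refine tendsto_norm_twist_mul ht ?_
      have := Fin.le_def.1 hjk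
      omega
    · exact Subring.zero_mem _
  let g : Fin r → TateDisc (theta Fq s) := fun j => ⟨_, hmem j⟩
  have hc (j : Fin r) (n : ℕ) : PowerSeries.coeff n (g j).1 = φ.solutionCoeff h j n :=
    PowerSeries.coeff_mk n (φ.solutionCoeff h j)
  have htower : φ.tower g = h := by
    funext n
    rw [tower, hc, solutionCoeff_last, map_mul, twist_twist, twist_twist, ← mul_assoc]
    have e : -1 + (1 - (r : ℤ)) = -r := by ring
    rw [e, leadingInvTwist_mul]
    simp [twist]
  have hg : g ∈ φ.V := by
    funext j
    ext1 n
    obtain ⟨j, hj⟩ := j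
    cases j with
    | zero =>
      have e1 := φ.vecMul_PhiSeries_first fun j => invTwist (g j).1
      have e2 := hc φ.firstIndex n
      rw [solutionCoeff_first] at e2
      refine (congrArg (PowerSeries.coeff n) e1).trans (Eq.trans ?_ e2.symm)
      rw [← htower] at hh ⊢
      cases n with
      | zero =>
        rw [hh.zero]
        simp only [sub_mul, map_sub, PowerSeries.coeff_zero_X_mul, PowerSeries.coeff_C_mul,
          coeff_invTwist, tower]
      | succ n =>
        rw [hh.succ]
        simp only [sub_mul, map_sub, PowerSeries.coeff_succ_X_mul, PowerSeries.coeff_C_mul,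
          coeff_invTwist, tower]
    | succ j =>
      rw [vecMul_PhiSeries_succ, hc, solutionCoeff_succ, ← hc, ← htower]
      simp only [map_sub, PowerSeries.coeff_C_mul, coeff_invTwist, tower]
  refine ⟨g, hg, ?_⟩
  have h1 := tendsto_tower hg
  rw [htower] at h1
  exact neg_injective (tendsto_nhds_unique h1 ht)

lemma bijOn_D0 : Set.BijOn φ.D0 φ.V (φ.periodLattice : Set (Tate Fq s)) :=
  ⟨φ.mapsTo_D0, φ.injOn_D0, φ.surjOn_D0⟩

end DrinfeldModule

/-! ### Series fixed by the twist. -/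

namespace CInfty
variable {Fq : Type*} [Field Fq] [Fintype Fq]

/-- `X ^ q - X` already splits over `𝔽_q`, so it has no further roots in `ℂ_∞`. -/
lemma exists_algebraMap_eq {a : CInfty Fq} (ha : a ^ Fintype.card Fq = a) :
    ∃ b : Fq, algebraMap Fq (CInfty Fq) b = a := by
  have hs : (Polynomial.X ^ Fintype.card Fq - Polynomial.X : Polynomial Fq).Splits := by
    rw [Polynomial.splits_iff_card_roots, FiniteField.roots_X_pow_card_sub_X,
      FiniteField.X_pow_card_sub_X_natDegree_eq _ Fintype.one_lt_card]
    rfl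
  refine hs.mem_range_of_isRoot (FiniteField.X_pow_card_sub_X_ne_zero _ Fintype.one_lt_card)
    (i := algebraMap Fq (CInfty Fq)) (x := a) ?_
  simp [ha]

lemma eq_zero_of_pow_card_eq {a : CInfty Fq} (ha : a ^ Fintype.card Fq = a) (h1 : ‖a‖ < 1) :
    a = 0 := by
  by_contra h0
  have h2 := pow_lt_self_of_lt_one₀ (norm_pos_iff.2 h0) h1 (Fintype.one_lt_card (α := Fq))
  rw [← norm_pow, ha] at h2
  exact h2.false

end CInfty

namespace Tate
variable {Fq : Type*} [Field Fq] [Fintype Fq] {s : ℕ}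

lemma twist_neg_one_eq_self_iff {f : Tate Fq s} :
    twist (-1) f = f ↔ ∀ ν, coeff ν f ^ Fintype.card Fq = coeff ν f := by
  have h : twist 1 (twist (-1) f) = f := by
    rw [twist_twist, add_neg_cancel]
    rfl
  rw [← (twist (Fq := Fq) (s := s) 1).injective.eq_iff, h, eq_comm]
  refine ⟨fun e ν => ?_, fun e => ext fun ν => ?_⟩
  · conv_rhs => rw [← e]
    exact (coeff_tau ν f).symm.trans (by simp [twist])
  · exact Eq.trans (by simp [twist, coeff_tau]) (e ν)

lemma coeff_mul_X (f : Tate Fq s) (i : Fin s) (ν : Fin s →₀ ℕ) :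
    coeff ν (f * X i) = if i ∈ ν.support then coeff (ν - Finsupp.single i 1) f else 0 := by
  classical
  have h := MvPowerSeries.coeff_mul_monomial (R := CInfty Fq) ν (Finsupp.single i 1) f.1 1
  refine h.trans ?_
  simp only [Finsupp.single_le_iff, Nat.one_le_iff_ne_zero, Finsupp.mem_support_iff, mul_one]
  rfl

end Tate

namespace TateDisc
variable {Fq : Type*} [Field Fq] [Fintype Fq] {s : ℕ}

variable (Fq s) in
/-- The map `𝔽_q[z][t_1, …, t_s] → 𝕋_s{z/θ}`. -/
def ofPoly : MvPolynomial (Fin s) (Polynomial Fq) →+* TateDisc (Tate.theta Fq s) :=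
  MvPolynomial.eval₂Hom (Polynomial.eval₂RingHom
    ((const (Tate.theta Fq s)).comp ((Tate.C Fq s).comp (algebraMap Fq (CInfty Fq))))
    (var (Tate.theta Fq s))) fun i => const (Tate.theta Fq s) (Tate.X i)

lemma eval_ofPoly (p : MvPolynomial (Fin s) (Polynomial Fq)) :
    eval (Tate.theta Fq s) (ofPoly Fq s p) = Tate.ofPoly Fq s p := by
  have h : (evalHom (Tate.theta Fq s)).comp (ofPoly Fq s) = Tate.ofPoly Fq s := by
    refine MvPolynomial.ringHom_ext' (Polynomial.ringHom_ext' ?_ ?_) fun i => ?_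
    · ext b : 1
      simpa [ofPoly, Tate.ofPoly] using! eval_const _ _
    · simpa [ofPoly, Tate.ofPoly] using! eval_var _
    · simpa [ofPoly, Tate.ofPoly] using! eval_const _ _
  exact RingHom.congr_fun h p

lemma coeff_ofPoly (p : MvPolynomial (Fin s) (Polynomial Fq)) (n : ℕ) (ν : Fin s →₀ ℕ) :
    Tate.coeff ν (PowerSeries.coeff n (ofPoly Fq s p).1) =
      algebraMap Fq (CInfty Fq) ((p.coeff ν).coeff n) := by
  classical
  induction p using MvPolynomial.induction_on generalizing ν with
  | C p =>
    induction p using Polynomial.induction_on' with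
    | add p₁ p₂ h₁ h₂ =>
      rw [map_add, map_add, Subring.coe_add, map_add, Tate.coeff_add, h₁, h₂,
        MvPolynomial.coeff_add, Polynomial.coeff_add, map_add]
    | monomial m b =>
      have e : (ofPoly Fq s (MvPolynomial.C (Polynomial.monomial m b))).1 =
          PowerSeries.C (Tate.C Fq s (algebraMap Fq (CInfty Fq) b)) * PowerSeries.X ^ m := by
        simp [ofPoly, coe_const, coe_var]
      rw [e, PowerSeries.coeff_C_mul, PowerSeries.coeff_X_pow, mul_ite, mul_one, mul_zero,
        MvPolynomial.coeff_C]
      by_cases h1 : n = m <;> by_cases h2 : ν = 0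
      · simp [h1, h2, Tate.coeff_C]
      · simp [h1, h2, Ne.symm h2, Tate.coeff_C]
      · simp [h1, h2, Tate.coeff_zero, Polynomial.coeff_monomial, Ne.symm h1]
      · simp [h1, Ne.symm h2, Tate.coeff_zero]
  | add p₁ p₂ h₁ h₂ =>
    rw [map_add, Subring.coe_add, map_add, Tate.coeff_add, h₁, h₂,
      MvPolynomial.coeff_add, Polynomial.coeff_add, map_add]
  | mul_X p i h =>
    have e : (ofPoly Fq s (p * MvPolynomial.X i)).1 =
        (ofPoly Fq s p).1 * PowerSeries.C (Tate.X i) := by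
      simp [ofPoly, coe_const]
    rw [e, PowerSeries.coeff_mul_C, Tate.coeff_mul_X, MvPolynomial.coeff_mul_X']
    split_ifs with hi
    · exact h _
    · simp

lemma ofPoly_injective : Function.Injective (ofPoly Fq s) := by
  intro p p' h
  ext ν n
  have e := coeff_ofPoly p n ν
  rw [h, coeff_ofPoly] at e
  exact ((algebraMap Fq (CInfty Fq)).injective e).symm

/-- The elements of `𝕋_s{z/θ}` that are fixed by the twist are the polynomials over `𝔽_q`. -/
lemma invTwist_eq_self_iff {f : TateDisc (Tate.theta Fq s)} :
    DrinfeldModule.invTwist f.1 = f.1 ↔ f ∈ Set.range (ofPoly Fq s) := by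
  classical
  constructor
  · intro hf
    have hfix (n : ℕ) (ν : Fin s →₀ ℕ) : Tate.coeff ν (PowerSeries.coeff n f.1) ^
        Fintype.card Fq = Tate.coeff ν (PowerSeries.coeff n f.1) := by
      refine Tate.twist_neg_one_eq_self_iff.1 ?_ ν
      rw [← DrinfeldModule.coeff_invTwist, hf]
    choose b hb using fun n ν => CInfty.exists_algebraMap_eq (hfix n ν)
    -- A fixed coefficient of norm below one is zero, so the Tate condition leaves finitely many
    -- monomials in `t`; convergence in `z` then bounds the degree in `z` uniformly in `ν`.
    have hfin (n : ℕ) : {ν | b n ν ≠ 0}.Finite := by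
      have h := (Tate.tendsto_coeff (PowerSeries.coeff n f.1)).eventually (gt_mem_nhds one_pos)
      rw [Filter.eventually_cofinite] at h
      refine h.subset fun ν hν h1 => hν ?_
      have h2 := CInfty.eq_zero_of_pow_card_eq (hfix n ν) h1
      rwa [← hb, map_eq_zero] at h2
    obtain ⟨N, hN⟩ := eventually_atTop.1
      (((mem_iff _ f.1).1 f.2).eventually (gt_mem_nhds one_pos))
    have hbN (n : ℕ) (hn : N ≤ n) (ν : Fin s →₀ ℕ) : b n ν = 0 := by
      have h1 : ‖PowerSeries.coeff n f.1‖ < 1 := by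
        refine lt_of_le_of_lt (le_mul_of_one_le_right (norm_nonneg _) ?_) (hN n hn)
        rw [Tate.norm_theta]
        exact one_le_pow₀ Tate.one_lt_card.le
      have h2 := CInfty.eq_zero_of_pow_card_eq (hfix n ν) ((Tate.coeff_le_norm _ ν).trans_lt h1)
      rwa [← hb, map_eq_zero] at h2
    refine ⟨∑ n ∈ Finset.range N, ∑ ν ∈ (hfin n).toFinset,
      MvPolynomial.monomial ν (Polynomial.monomial n (b n ν)), Subtype.ext ?_⟩
    ext n ν
    rw [coeff_ofPoly, ← hb]
    congr 1
    simp only [MvPolynomial.coeff_sum, MvPolynomial.coeff_monomial, Polynomial.finsetSum_coeff,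
      Finset.sum_ite_eq', Set.Finite.mem_toFinset, Set.mem_ofPred_eq,
      apply_ite (Polynomial.coeff · n),
      Polynomial.coeff_monomial, Polynomial.coeff_zero]
    rw [Finset.sum_eq_single n]
    · by_cases h : b n ν = 0 <;> simp [h]
    · intro m _ hm
      simp [hm]
    · intro h
      rw [hbN n (by simpa using h)]
      simp
  · rintro ⟨p, rfl⟩
    ext1 n
    rw [DrinfeldModule.coeff_invTwist, Tate.twist_neg_one_eq_self_iff]
    intro ν
    rw [coeff_ofPoly, ← map_pow, FiniteField.pow_card]

end TateDisc

/-! ### Freeness from the rigid analytic trivialization. -/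

namespace DrinfeldModule
variable {Fq : Type*} [Field Fq] [Fintype Fq] {s r : ℕ} {φ : DrinfeldModule Fq s r}
  {Ψ : Matrix.GeneralLinearGroup (Fin r) (TateDisc (Tate.theta Fq s))}

/-- Since `(gΨ)^{(-1)} = g^{(-1)} Φ Ψ`, the condition is the defining equation multiplied by `Ψ`,
which can be cancelled. The computation takes place in `𝕋_s[[z]]`, where twists are defined. -/
lemma IsRigidAnalyticTrivialization.mem_V_iff (hΨ : φ.IsRigidAnalyticTrivialization Ψ)
    (g : Fin r → TateDisc (Tate.theta Fq s)) :
    g ∈ φ.V ↔ ∀ j, invTwist (Matrix.vecMul g Ψ.val j).1 = (Matrix.vecMul g Ψ.val j).1 := by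
  let ι := (TateDisc (Tate.theta Fq s)).subtype
  let T : PowerSeries (Tate Fq s) →+* PowerSeries (Tate Fq s) :=
    PowerSeries.map (Tate.twist (-1) : Tate Fq s ≃+* Tate Fq s).toRingHom
  have hM : Ψ.val.map (T.comp ι) = φ.PhiSeries * Ψ.val.map ι := hΨ
  have hinv : Ψ.val.map ι * (Ψ⁻¹).val.map ι = 1 := by
    rw [← Matrix.map_mul, ← Units.val_mul, mul_inv_cancel, Units.val_one,
      Matrix.map_one _ (map_zero _) (map_one _)]
  have h1 : (fun j => T (ι (Matrix.vecMul g Ψ.val j))) =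
      Matrix.vecMul (Matrix.vecMul (fun j => T (ι (g j))) φ.PhiSeries) (Ψ.val.map ι) := by
    rw [Matrix.vecMul_vecMul, ← hM]
    exact funext fun j => RingHom.map_vecMul (T.comp ι) Ψ.val g j
  have h2 : (fun j => ι (Matrix.vecMul g Ψ.val j)) =
      Matrix.vecMul (fun j => ι (g j)) (Ψ.val.map ι) :=
    funext fun j => RingHom.map_vecMul ι Ψ.val g j
  change Matrix.vecMul (fun j => T (ι (g j))) φ.PhiSeries = (fun j => ι (g j)) ↔
    ∀ j, T (ι (Matrix.vecMul g Ψ.val j)) = ι (Matrix.vecMul g Ψ.val j)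
  rw [← funext_iff, h1, h2]
  refine ⟨fun h => by rw [h], fun h => ?_⟩
  have h3 := congrArg (Matrix.vecMul · ((Ψ⁻¹).val.map ι)) h
  simpa only [Matrix.vecMul_vecMul, Matrix.mul_assoc, hinv, Matrix.mul_one, Matrix.vecMul_one] using h3

/-- Evaluation at `z = θ` turns the action of `𝔽_q[z][t]` on row vectors into that of `A[t_s]` on
`𝕋_s`. -/
lemma D0_smul (p : MvPolynomial (Fin s) (Polynomial Fq))
    (g : Fin r → TateDisc (Tate.theta Fq s)) :
    φ.D0 (TateDisc.ofPoly Fq s p • g) = p • φ.D0 g := by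
  refine (TateDisc.eval_mul _ _ _).trans ?_
  rw [TateDisc.eval_ofPoly]
  rfl

lemma D0_add (f g : Fin r → TateDisc (Tate.theta Fq s)) : φ.D0 (f + g) = φ.D0 f + φ.D0 g :=
  TateDisc.eval_add _ _ _

/-- The row vector `c Ψ⁻¹`, for a row vector `c` of polynomials over `𝔽_q`. -/
def trivializationSection (Ψ : Matrix.GeneralLinearGroup (Fin r) (TateDisc (Tate.theta Fq s)))
    (c : Fin r → MvPolynomial (Fin s) (Polynomial Fq)) : Fin r → TateDisc (Tate.theta Fq s) :=
  Matrix.vecMul (fun j => TateDisc.ofPoly Fq s (c j)) (Ψ⁻¹).val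

lemma trivializationSection_vecMul (c : Fin r → MvPolynomial (Fin s) (Polynomial Fq)) :
    Matrix.vecMul (trivializationSection Ψ c) Ψ.val = fun j => TateDisc.ofPoly Fq s (c j) := by
  rw [trivializationSection, Matrix.vecMul_vecMul, ← Units.val_mul, inv_mul_cancel, Units.val_one,
    Matrix.vecMul_one]

lemma trivializationSection_add (c d : Fin r → MvPolynomial (Fin s) (Polynomial Fq)) :
    trivializationSection Ψ (c + d) = trivializationSection Ψ c + trivializationSection Ψ d := by
  unfold trivializationSection
  rw [← Matrix.add_vecMul]
  congr 1
  funext j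
  exact map_add _ _ _

lemma trivializationSection_smul (p : MvPolynomial (Fin s) (Polynomial Fq))
    (c : Fin r → MvPolynomial (Fin s) (Polynomial Fq)) :
    trivializationSection Ψ (p • c) = TateDisc.ofPoly Fq s p • trivializationSection Ψ c := by
  unfold trivializationSection
  rw [← Matrix.smul_vecMul]
  congr 1
  funext j
  exact map_mul _ _ _

lemma IsRigidAnalyticTrivialization.section_mem_V (hΨ : φ.IsRigidAnalyticTrivialization Ψ)
    (c : Fin r → MvPolynomial (Fin s) (Polynomial Fq)) : trivializationSection Ψ c ∈ φ.V := by
  rw [hΨ.mem_V_iff, trivializationSection_vecMul]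
  exact fun j => TateDisc.invTwist_eq_self_iff.2 ⟨c j, rfl⟩

lemma IsRigidAnalyticTrivialization.exists_section_eq (hΨ : φ.IsRigidAnalyticTrivialization Ψ)
    {g : Fin r → TateDisc (Tate.theta Fq s)} (hg : g ∈ φ.V) :
    ∃ c, trivializationSection Ψ c = g := by
  choose c hc using fun j => TateDisc.invTwist_eq_self_iff.1 ((hΨ.mem_V_iff g).1 hg j)
  refine ⟨c, ?_⟩
  rw [trivializationSection, funext hc]
  rw [Matrix.vecMul_vecMul, ← Units.val_mul, mul_inv_cancel, Units.val_one, Matrix.vecMul_one]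

/-- The parametrization of the period lattice by row vectors of polynomials that a rigid analytic
trivialization provides. -/
def IsRigidAnalyticTrivialization.periodMap (hΨ : φ.IsRigidAnalyticTrivialization Ψ) :
    (Fin r → MvPolynomial (Fin s) (Polynomial Fq)) →ₗ[MvPolynomial (Fin s) (Polynomial Fq)]
      φ.periodLattice where
  toFun c := ⟨φ.D0 (trivializationSection Ψ c), φ.mapsTo_D0 (hΨ.section_mem_V c)⟩
  map_add' c d := Subtype.ext <| by
    rw [Submodule.coe_add, ← D0_add, ← trivializationSection_add]
  map_smul' p c := Subtype.ext <| by
    rw [RingHom.id_apply, Submodule.coe_smul, ← D0_smul, ← trivializationSection_smul]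

/-- Injectivity recovers `c` from `c Ψ⁻¹` on multiplying by `Ψ`; surjectivity lifts a period to some
`g` in `V_φ` and takes `c = g Ψ`. -/
lemma IsRigidAnalyticTrivialization.periodMap_bijective
    (hΨ : φ.IsRigidAnalyticTrivialization Ψ) : Function.Bijective hΨ.periodMap := by
  constructor
  · intro c d h
    have h1 := φ.injOn_D0 (hΨ.section_mem_V c) (hΨ.section_mem_V d) (congrArg Subtype.val h)
    have h2 := trivializationSection_vecMul (Ψ := Ψ) c
    rw [h1, trivializationSection_vecMul] at h2
    exact funext fun j => (TateDisc.ofPoly_injective (congrFun h2 j)).symm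
  · rintro ⟨l, hl⟩
    obtain ⟨g, hg, rfl⟩ := φ.surjOn_D0 hl
    obtain ⟨c, rfl⟩ := hΨ.exists_section_eq hg
    exact ⟨c, rfl⟩

end DrinfeldModule

end

end TateDrinfeld

theorem theorem4 {Fq : Type*} [Field Fq] [Fintype Fq] {s r : ℕ} (φ : DrinfeldModule Fq s r)
    (Ψ : Matrix.GeneralLinearGroup (Fin r) (TateDisc (Tate.theta Fq s)))
    (hΨ : φ.IsRigidAnalyticTrivialization Ψ) :
    Set.BijOn φ.D0 φ.V (φ.periodLattice : Set (Tate Fq s)) ∧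
      Module.Free (MvPolynomial (Fin s) (Polynomial Fq)) φ.periodLattice ∧
      Module.Finite (MvPolynomial (Fin s) (Polynomial Fq)) φ.periodLattice ∧
      Module.finrank (MvPolynomial (Fin s) (Polynomial Fq)) φ.periodLattice = r := by
  let e := LinearEquiv.ofBijective hΨ.periodMap hΨ.periodMap_bijective
  refine ⟨φ.bijOn_D0, Module.Free.of_equiv e, Module.Finite.equiv e, ?_⟩
  rw [← e.finrank_eq, Module.finrank_fin_fun]
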